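/- Let $N\ge 2$ and let $\mathbb H^N=\mathbb R^N\times\mathbb R^N\times\mathbb R$ be the Heisenberg group with group law $(x,y,t)\circ(x',y',t')=(x+x',\,y+y',\,t+t'+2\langle y,x'\rangle-2\langle x,y'\rangle)$, inverse $\xi^{-1}=-\xi$, Korányi norm $|(x,y,t)|=\big((|x|^2+|y|^2)^2+t^2\big)^{1/4}$, Lebesgue measure, and homogeneous dimension $Q=2N+2$. Let $0<s<1<p<\infty$ with $sp<Q$, and let $\Omega\subset\mathbb H^N$ be a bounded smooth domain. All pointwise relations between functions are understood almost everywhere. For open $\omega\subset\mathbb H^N$, let $HW^{s,p}(\omega)$ be the set of $u\in L^p(\omega)$ with $\frac{|u(x)-u(y)|}{|y^{-1}\circ x|^{s+Q/p}}\in L^p(\omega\times\omega)$. Let $HW^{s,p}_{\rm loc}(\Omega)$ be the set of $u$ with $u\in HW^{s,p}(\omega)$ for every open $\omega\Subset\Omega$, and let $HW^{s,p}_0(\Omega)=\{u\in HW^{s,p}(\mathbb H^N): u=0 \text{ in } \mathbb H^N\setminus\Omega\}$. Given $\delta>0$ and $f\in L^1(\Omega)$, a weak solution of $$L_{s,p}u=f\,u^{-\delta}\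 \text{ in }\Omega,\qquad u>0\ \text{ in }\Omega,\qquad u=0\ \text{ in }\mathbb H^N\setminus\Omega,\tag{P}$$ where $L_{s,p}u(x)=\mathrm{P.V.}\int_{\mathbb H^N}\frac{|u(x)-u(y)|^{p-2}(u(x)-u(y))}{|y^{-1}\circ x|^{Q+sp}}\,dy$, is a function $u:\mathbb H^N\to\mathbb R$ with $u\in HW^{s,p}_{\rm loc}(\Omega)\cap L^{p-1}(\Omega)$ such that 1. $u=0$ in $\mathbb H^N\setminus\Omega$, $u\ge 0$, and $(u-\theta)^+\in HW^{s,p}_0(\Omega)$ for every $\theta>0$ (this is the meaning of $u=0$ on $\partial\Omega$); 2. for every open $\omega\Subset\Omega$ there is a constant $C=C(\omega)>0$ with $u\ge C$ in $\omega$; 3. for every $\varphi\in C^1_c(\Omega)$, $$\int_{\mathbb H^N}\int_{\mathbb H^N}\frac{|u(x)-u(y)|^{p-2}(u(x)-u(y))(\varphi(x)-\varphi(y))}{|y^{-1}\circ x|^{Q+sp}}\,dx\,dy=\int_\Omega f\,u^{-\delta}\varphi\,dx .$$ **Theorem (uniqueness).** Let $\delta>0$ be a constant and let $f\in L^1(\Omega)\setminus\{0\}$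 be nonnegative. Then (P) has at most one weak solution in $HW^{s,p}_{\rm loc}(\Omega)\cap L^{p-1}(\Omega)$: any two weak solutions coincide almost everywhere in $\mathbb H^N$. -/

import Mathlib

open MeasureTheory

noncomputable section

namespace HeisUniq

/-- The underlying manifold `ℝ^N × ℝ^N × ℝ` of the Heisenberg group, with points `(x, y, t)`.
Its `volume` is Lebesgue measure on `ℝ^(2N+1)`, the Haar measure of the group. -/
abbrev Heis (N : ℕ) : Type :=
  EuclideanSpace ℝ (Fin N) × EuclideanSpace ℝ (Fin N) × ℝ

/-- The group law
`(x,y,t) ∘ (x',y',t') = (x + x', y + y', t + t' + 2⟨y,x'⟩ - 2⟨x,y'⟩)`. -/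
def hmul {N : ℕ} (ξ η : Heis N) : Heis N :=
  (ξ.1 + η.1, ξ.2.1 + η.2.1,
    ξ.2.2 + η.2.2 + 2 * inner ℝ ξ.2.1 η.1 - 2 * inner ℝ ξ.1 η.2.1)

/-- The group inverse `ξ⁻¹ = -ξ`. -/
def hinv {N : ℕ} (ξ : Heis N) : Heis N := -ξ

theorem hmul_hinv {N : ℕ} (ξ : Heis N) : hmul ξ (hinv ξ) = 0 := by
  ext <;> simp [hmul, hinv, real_inner_comm]

theorem hinv_hmul {N : ℕ} (ξ : Heis N) : hmul (hinv ξ) ξ = 0 := by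
  ext <;> simp [hmul, hinv, real_inner_comm]

theorem hmul_assoc {N : ℕ} (ξ η ζ : Heis N) :
    hmul (hmul ξ η) ζ = hmul ξ (hmul η ζ) := by
  ext <;> simp [hmul, inner_add_left, inner_add_right] <;> ring

/-- The Korányi norm `((|x|² + |y|²)² + t²)^(1/4)`. -/
def koranyi {N : ℕ} (ξ : Heis N) : ℝ :=
  ((‖ξ.1‖ ^ 2 + ‖ξ.2.1‖ ^ 2) ^ 2 + ξ.2.2 ^ 2) ^ (1 / 4 : ℝ)

/-- The distance `|η⁻¹ ∘ ξ|`. -/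
def hdist {N : ℕ} (ξ η : Heis N) : ℝ := koranyi (hmul (hinv η) ξ)

/-- The homogeneous dimension `Q = 2N + 2`. -/
def homDim (N : ℕ) : ℝ := 2 * (N : ℝ) + 2

/-- `J_p(t) = |t|^(p-2) t`. -/
def Jp (p t : ℝ) : ℝ := |t| ^ (p - 2) * t

/-- A bounded smooth domain: nonempty, open, connected, bounded, and near each boundary point of
the form `{ρ < 0}` for a smooth `ρ` with nonvanishing differential at that point. -/
structure IsSmoothBoundedDomain {N : ℕ} (Ω : Set (Heis N)) : Prop where
  isOpen : IsOpen Ω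
  isConnected : IsConnected Ω
  isBounded : Bornology.IsBounded Ω
  smooth_boundary : ∀ ξ ∈ frontier Ω, ∃ U : Set (Heis N), IsOpen U ∧ ξ ∈ U ∧
    ∃ ρ : Heis N → ℝ, ContDiffOn ℝ ((⊤ : ℕ∞) : WithTop ℕ∞) ρ U ∧ fderiv ℝ ρ ξ ≠ 0 ∧
      Ω ∩ U = {η | η ∈ U ∧ ρ η < 0}

/-- `u ∈ HW^{s,p}(ω)`: `u ∈ L^p(ω)` and `|u(x) - u(y)| / |y⁻¹ ∘ x|^(s + Q/p) ∈ L^p(ω × ω)`. -/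
def MemHW {N : ℕ} (s p : ℝ) (ω : Set (Heis N)) (u : Heis N → ℝ) : Prop :=
  MemLp u (ENNReal.ofReal p) (volume.restrict ω) ∧
  MemLp (fun z : Heis N × Heis N => |u z.1 - u z.2| / hdist z.1 z.2 ^ (s + homDim N / p))
    (ENNReal.ofReal p) ((volume.restrict ω).prod (volume.restrict ω))

/-- `u = 0` almost everywhere outside `Ω`. -/
def ZeroOutside {N : ℕ} (Ω : Set (Heis N)) (u : Heis N → ℝ) : Prop :=
  ∀ᵐ x ∂(volume : Measure (Heis N)), x ∉ Ω → u x = 0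

/-- `u ∈ HW_0^{s,p}(Ω)`: `u ∈ HW^{s,p}(ℍ^N)` and `u = 0` in `ℍ^N \ Ω`. -/
def MemHW0 {N : ℕ} (s p : ℝ) (Ω : Set (Heis N)) (u : Heis N → ℝ) : Prop :=
  MemHW s p Set.univ u ∧ ZeroOutside Ω u

/-- `ω ⋐ Ω`, for open `ω`. -/
def CompactlyInside {N : ℕ} (ω Ω : Set (Heis N)) : Prop :=
  IsOpen ω ∧ IsCompact (closure ω) ∧ closure ω ⊆ Ω

/-- `u ∈ HW^{s,p}_loc(Ω)`. -/
def MemHWloc {N : ℕ} (s p : ℝ) (Ω : Set (Heis N)) (u : Heis N → ℝ) : Prop :=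
  ∀ ω : Set (Heis N), CompactlyInside ω Ω → MemHW s p ω u

/-- `u ≤ 0` on `∂Ω`: `(u - θ)⁺ ∈ HW_0^{s,p}(Ω)` for every `θ > 0`. -/
def NonposOnBoundary {N : ℕ} (s p : ℝ) (Ω : Set (Heis N)) (u : Heis N → ℝ) : Prop :=
  ∀ θ : ℝ, 0 < θ → MemHW0 s p Ω (fun x => max (u x - θ) 0)

/-- `u = 0` on `∂Ω`: `u` is nonnegative and `u ≤ 0` on `∂Ω`. -/
def ZeroOnBoundary {N : ℕ} (s p : ℝ) (Ω : Set (Heis N)) (u : Heis N → ℝ) : Prop :=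
  (∀ᵐ x ∂(volume : Measure (Heis N)), 0 ≤ u x) ∧ NonposOnBoundary s p Ω u

/-- Weak solutions of `L_{s,p} u = f u^(-δ)` in `Ω`, `u > 0` in `Ω`, `u = 0` in `ℍ^N \ Ω`.
Both integrals in the weak formulation converge absolutely as a consequence of the other
conditions when `f ∈ L^1(Ω)` and `δ` is bounded. -/
structure IsWeakSolution {N : ℕ} (s p : ℝ) (Ω : Set (Heis N)) (f δ u : Heis N → ℝ) : Prop where
  memHWloc : MemHWloc s p Ω u
  memLp : MemLp u (ENNReal.ofReal (p - 1)) (volume.restrict Ω)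
  zeroOutside : ZeroOutside Ω u
  zeroOnBoundary : ZeroOnBoundary s p Ω u
  locally_bounded_below : ∀ ω : Set (Heis N), CompactlyInside ω Ω →
    ∃ C : ℝ, 0 < C ∧ ∀ᵐ x ∂(volume.restrict ω), C ≤ u x
  weak_eq : ∀ φ : Heis N → ℝ, ContDiff ℝ 1 φ → HasCompactSupport φ → tsupport φ ⊆ Ω →
    ∫ z : Heis N × Heis N,
        Jp p (u z.1 - u z.2) * (φ z.1 - φ z.2) / hdist z.1 z.2 ^ (homDim N + s * p)
        ∂((volume : Measure (Heis N)).prod volume)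
      = ∫ x in Ω, f x * u x ^ (-δ x) * φ x

end HeisUniq

end

/-!
Let `u` and `v` be two weak solutions, `θ > 0` and `r = (u - θ)⁺`; by symmetry it suffices to show
`r ≤ v`. Write `dg (x, y) = g x - g y`, let `m` be the measure `|y⁻¹ ∘ x|^(-(Q + s p)) dx dy`, and
`J = J_p`. The difficulty is that `v` may have infinite energy, so that `(r - v)⁺` cannot simply be
inserted in the two equations.

The boundary condition says that `r` has finite energy and vanishes off `Ω`, hence it is a limit in
the energy norm of functions with compact support in `Ω`
(`FiniteEnergy.compactlyApproximable`): left translations are isometries of the energy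
norm, they act continuously on `L^p`, and near each boundary point of a smooth domain suitable small
left translations push the closure of the domain into its interior. Taking minima with `r` gives
`ρ ≤ r` with compact support and close to `r`. The function `φ = trunc (ρ - v)`, with values in
`[0, 1]`, has compact support in `Ω`, and finite energy because `v` has locally finite energy.
Mollifying along left translations shows that such `φ` are admissible in the weak equations
(`IsRegularSolution.weak_eq`).

Where `φ > 0` one has `θ < u` and `v < u`, so that, `f` being nonnegative and `t ↦ t^(-δ)`
decreasing,
`∫ J(dr) dφ dm ≤ ∫ J(du) dφ dm = ∫ f u^(-δ) φ ≤ ∫ f v^(-δ) φ = ∫ J(dv) dφ dm`, where the last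
integral is nonnegative (`IsRegularSolution.pairing_le`). An elementary pointwise
inequality turns this nonnegativity into a bound for the energy of `φ` by that of `ρ` alone
(`eLpNorm_incr_trunc_le`). Consequently
`0 ≤ ∫ (J(dρ) - J(dv)) dφ dm ≤ ∫ (J(dρ) - J(dr)) dφ dm`, and the right-hand side tends to zero as
`ρ → r`. The left integrand is nonnegative by monotonicity of `J`, so by Fatou's lemma
`(J(dr) - J(dv)) d(trunc (r - v)) = 0` almost everywhere. Hence `trunc (r - v)` is constant, and it
vanishes off `Ω`.
-/

noncomputable section

namespace HeisUniq

open Filter Topology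

/-! ### The nonlinearity `t ↦ |t|^(p-2) t` -/

theorem abs_Jp {p : ℝ} (hp : 1 < p) (t : ℝ) : |Jp p t| = |t| ^ (p - 1) := by
  rcases eq_or_ne t 0 with rfl | ht
  · simp [Jp, Real.zero_rpow (by linarith : p - 1 ≠ 0)]
  · have h : 0 < |t| := abs_pos.2 ht
    rw [Jp, abs_mul, abs_of_nonneg (by positivity), ← Real.rpow_add_one h.ne']
    ring_nf

theorem Jp_of_nonneg {p : ℝ} (hp : 1 < p) {t : ℝ} (ht : 0 ≤ t) : Jp p t = t ^ (p - 1) := by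
  have h := abs_Jp hp t
  rwa [abs_of_nonneg (by unfold Jp; positivity), abs_of_nonneg ht] at h

theorem Jp_neg (p t : ℝ) : Jp p (-t) = -Jp p t := by simp [Jp]

theorem Jp_strictMono {p : ℝ} (hp : 1 < p) : StrictMono (Jp p) := by
  have hpos : ∀ a b : ℝ, 0 ≤ a → a < b → Jp p a < Jp p b := fun a b ha hab => by
    rw [Jp_of_nonneg hp ha, Jp_of_nonneg hp (ha.trans hab.le)]
    exact Real.rpow_lt_rpow ha hab (by linarith)
  have h0 : Jp p 0 = 0 := by simp [Jp]
  intro a b hab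
  rcases le_or_gt 0 a with ha | ha
  · exact hpos a b ha hab
  rcases le_or_gt 0 b with hb | hb
  · have h1 := hpos 0 (-a) le_rfl (by linarith)
    rw [Jp_neg, h0] at h1
    rcases hb.eq_or_lt with rfl | hb'
    · linarith
    · have h2 := hpos 0 b le_rfl hb'
      linarith
  · have h1 := hpos (-b) (-a) (by linarith) (by linarith)
    rw [Jp_neg, Jp_neg] at h1
    linarith

theorem continuous_Jp {p : ℝ} (hp : 1 < p) : Continuous (Jp p) := by
  have : Jp p = fun t => (max t 0) ^ (p - 1) - (max (-t) 0) ^ (p - 1) := by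
    funext t
    have h0 : (0 : ℝ) ^ (p - 1) = 0 := Real.zero_rpow (by linarith)
    rcases le_total 0 t with ht | ht
    · rw [Jp_of_nonneg hp ht, max_eq_left ht, max_eq_right (by linarith), h0, sub_zero]
    · rw [max_eq_right ht, max_eq_left (by linarith : (0 : ℝ) ≤ -t),
        ← Jp_of_nonneg hp (by linarith : (0 : ℝ) ≤ -t), Jp_neg, h0]
      ring
  rw [this]
  have hp' : 0 ≤ p - 1 := by linarith
  exact ((continuous_id.max continuous_const).rpow_const fun _ => Or.inr hp').sub
    ((continuous_neg.max continuous_const).rpow_const fun _ => Or.inr hp')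

/-- `c` lies between `0` and `d`. This is how an increment of `τ ∘ g` relates to the increment of
`g` when `τ` is nondecreasing and `1`-Lipschitz. -/
def Between (c d : ℝ) : Prop := (0 ≤ c ∧ c ≤ d) ∨ (d ≤ c ∧ c ≤ 0)

theorem Between.abs_le {c d : ℝ} (h : Between c d) : |c| ≤ |d| := by
  rcases h with ⟨h0, h1⟩ | ⟨h0, h1⟩
  · rwa [abs_of_nonneg h0, abs_of_nonneg (h0.trans h1)]
  · rw [abs_of_nonpos h1, abs_of_nonpos (h0.trans h1)]; linarith

theorem Jp_sub_mul_nonneg {p : ℝ} (hp : 1 < p) {a b c : ℝ} (h : Between c (a - b)) :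
    0 ≤ (Jp p a - Jp p b) * c := by
  rcases h with ⟨h0, h1⟩ | ⟨h0, h1⟩
  · exact mul_nonneg (sub_nonneg.2 ((Jp_strictMono hp).monotone (by linarith))) h0
  · exact mul_nonneg_of_nonpos_of_nonpos
      (sub_nonpos.2 ((Jp_strictMono hp).monotone (by linarith))) h1

theorem eq_zero_of_Jp_sub_mul_eq_zero {p : ℝ} (hp : 1 < p) {a b c : ℝ} (h : Between c (a - b))
    (h0 : (Jp p a - Jp p b) * c = 0) : c = 0 := by
  rcases mul_eq_zero.1 h0 with h1 | h1
  · have hab := (Jp_strictMono hp).injective (sub_eq_zero.1 h1)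
    subst hab
    rcases h with ⟨h2, h3⟩ | ⟨h2, h3⟩ <;> linarith
  · exact h1

/-- Testing a supersolution `v` with `τ ((r - v)⁺)` controls the energy of the test function by
that of `r` alone: here `a`, `b`, `c` are the increments of `r`, `v` and the test function. Either
`b` is dominated by `a`, or `J_p(b) c` is negative and dominates `|c|^p`. -/
theorem rpow_abs_add_Jp_mul_le {p : ℝ} (hp : 1 < p) {a b c : ℝ} (h : Between c (a - b)) :
    |c| ^ p + 2 ^ p * (Jp p b * c) ≤ (3 ^ p + 6 ^ p) * |a| ^ p := by
  have hsplit : ∀ t : ℝ, 0 ≤ t → t ^ p = t ^ (p - 1) * t := fun t ht => by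
    rcases ht.eq_or_lt with rfl | ht
    · simp [Real.zero_rpow (by linarith : p ≠ 0)]
    · rw [← Real.rpow_add_one ht.ne']; ring_nf
  have hc := h.abs_le
  rcases le_or_gt |b| (2 * |a|) with hb | hb
  · have hc3 : |c| ≤ 3 * |a| := hc.trans ((abs_sub a b).trans (by linarith))
    have h1 : |c| ^ p ≤ 3 ^ p * |a| ^ p := by
      rw [← Real.mul_rpow (by norm_num) (abs_nonneg a)]
      exact Real.rpow_le_rpow (abs_nonneg _) hc3 (by linarith)
    have h2 : Jp p b * c ≤ 3 ^ p * |a| ^ p := by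
      calc Jp p b * c ≤ |Jp p b * c| := le_abs_self _
        _ = |b| ^ (p - 1) * |c| := by rw [abs_mul, abs_Jp hp]
        _ ≤ (3 * |a|) ^ (p - 1) * (3 * |a|) := by
          have : |b| ≤ 3 * |a| := by linarith [abs_nonneg a]
          gcongr
        _ = (3 * |a|) ^ p := (hsplit _ (by positivity)).symm
        _ = 3 ^ p * |a| ^ p := Real.mul_rpow (by norm_num) (abs_nonneg a)
    have h3 : (6 : ℝ) ^ p = 2 ^ p * 3 ^ p := by
      rw [← Real.mul_rpow (by norm_num) (by norm_num)]; norm_num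
    have h4 : (0 : ℝ) < 2 ^ p := by positivity
    rw [h3]
    nlinarith
  · have hsign : Jp p b * c = -(|b| ^ (p - 1) * |c|) := by
      have habs : |Jp p b * c| = |b| ^ (p - 1) * |c| := by rw [abs_mul, abs_Jp hp]
      rw [← habs, abs_of_nonpos, neg_neg]
      have hk : 0 ≤ |b| ^ (p - 2) := by positivity
      have hbc : b * c ≤ 0 := by
        rcases le_total 0 b with hb0 | hb0
        · rw [abs_of_nonneg hb0] at hb
          have : a ≤ b := by linarith [le_abs_self a, abs_nonneg a]
          rcases h with ⟨h0, h1⟩ | ⟨h0, h1⟩ <;> nlinarith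
        · rw [abs_of_nonpos hb0] at hb
          have : b ≤ a := by linarith [neg_abs_le a, abs_nonneg a]
          rcases h with ⟨h0, h1⟩ | ⟨h0, h1⟩ <;> nlinarith
      unfold Jp
      nlinarith
    have hc2 : |c| ≤ 2 * |b| := hc.trans ((abs_sub a b).trans (by linarith [abs_nonneg b]))
    have h1 : |c| ^ p ≤ 2 ^ p * (|b| ^ (p - 1) * |c|) := by
      calc |c| ^ p = |c| ^ (p - 1) * |c| := hsplit _ (abs_nonneg _)
        _ ≤ (2 * |b|) ^ (p - 1) * |c| := by
          gcongr
        _ = 2 ^ (p - 1) * (|b| ^ (p - 1) * |c|) := by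
          rw [Real.mul_rpow (by norm_num) (abs_nonneg b)]; ring
        _ ≤ 2 ^ p * (|b| ^ (p - 1) * |c|) := by
          gcongr
          · norm_num
          · linarith
    rw [hsign]
    have : 0 ≤ (3 ^ p + 6 ^ p) * |a| ^ p := by positivity
    linarith

theorem add_rpow_le_two_rpow {q x y : ℝ} (hq : 0 ≤ q) (hx : 0 ≤ x) (hy : 0 ≤ y) :
    (x + y) ^ q ≤ 2 ^ q * (x ^ q + y ^ q) := by
  have h : (x + y) ^ q ≤ (2 * max x y) ^ q :=
    Real.rpow_le_rpow (by positivity) (by linarith [le_max_left x y, le_max_right x y]) hq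
  rw [Real.mul_rpow (by norm_num) (hx.trans (le_max_left _ _))] at h
  refine h.trans ?_
  gcongr
  rcases max_cases x y with ⟨h1, -⟩ | ⟨h1, -⟩ <;> rw [h1]
  · linarith [Real.rpow_nonneg hy q]
  · linarith [Real.rpow_nonneg hx q]

/-- A quantitative continuity of `J_p`, valid for every `p > 1`. The small constant `η` in front of
`|b|^(p-1)` replaces the separate estimates for `p ≤ 2` and `p ≥ 2`. -/
theorem abs_Jp_sub_le {p : ℝ} (hp : 1 < p) {η : ℝ} (hη : 0 < η) :
    ∃ C : ℝ, 0 ≤ C ∧ ∀ a b : ℝ,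
      |Jp p a - Jp p b| ≤ η * |b| ^ (p - 1) + C * |a - b| ^ (p - 1) := by
  have hp' : 0 < p - 1 := by linarith
  obtain ⟨ϱ, hϱ, hcont⟩ := Metric.continuousAt_iff.1
    ((continuous_Jp hp).continuousAt (x := (1 : ℝ))) η hη
  have hJ1 : Jp p 1 = 1 := by simp [Jp]
  set C : ℝ := 2 ^ (p - 1) + (2 ^ (p - 1) + 1) * (ϱ⁻¹) ^ (p - 1) + 1 with hC
  have hC0 : 0 ≤ C := by positivity
  refine ⟨C, hC0, fun a b => ?_⟩
  -- by homogeneity it is enough to compare with `b = 1`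
  have key : ∀ x : ℝ, |Jp p x - 1| ≤ η + C * |x - 1| ^ (p - 1) := by
    intro x
    rcases lt_or_ge |x - 1| ϱ with hx | hx
    · have := hcont (x := x) (by rwa [Real.dist_eq])
      rw [Real.dist_eq, hJ1] at this
      have h2 : 0 ≤ C * |x - 1| ^ (p - 1) := by positivity
      linarith
    · have h1 : |Jp p x - 1| ≤ |x| ^ (p - 1) + 1 := by
        rw [← abs_Jp hp]
        simpa using abs_sub (Jp p x) 1
      have h2 : |x| ^ (p - 1) ≤ 2 ^ (p - 1) * (|x - 1| ^ (p - 1) + 1) := by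
        have h3 : |x| ≤ |x - 1| + 1 := by
          have := abs_add_le (x - 1) 1
          simpa using this
        have h4 := add_rpow_le_two_rpow hp'.le (abs_nonneg (x - 1)) zero_le_one
        rw [Real.one_rpow] at h4
        exact (Real.rpow_le_rpow (abs_nonneg _) h3 hp'.le).trans h4
      have h5 : 1 ≤ (ϱ⁻¹) ^ (p - 1) * |x - 1| ^ (p - 1) := by
        rw [← Real.mul_rpow (by positivity) (abs_nonneg _)]
        apply Real.one_le_rpow _ hp'.le
        rw [inv_mul_eq_div, le_div_iff₀ hϱ]
        linarith
      have h6 : (0 : ℝ) ≤ 2 ^ (p - 1) + 1 := by positivity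
      have h7 : 0 ≤ |x - 1| ^ (p - 1) := by positivity
      have h8 := mul_le_mul_of_nonneg_left h5 h6
      rw [hC]
      nlinarith
  rcases eq_or_ne b 0 with rfl | hb
  · have h0 : Jp p 0 = 0 := by simp [Jp]
    rw [h0, sub_zero, sub_zero, abs_Jp hp, abs_zero, Real.zero_rpow hp'.ne', mul_zero, zero_add]
    have h7 : 0 ≤ |a| ^ (p - 1) := by positivity
    have h8 : (0 : ℝ) ≤ 2 ^ (p - 1) + (2 ^ (p - 1) + 1) * (ϱ⁻¹) ^ (p - 1) := by positivity
    have : 1 ≤ C := by rw [hC]; linarith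
    nlinarith
  · have hbpos : 0 < |b| := abs_pos.2 hb
    have hhom : Jp p a = Jp p b * Jp p (a / b) := by
      unfold Jp
      rw [abs_div, Real.div_rpow (abs_nonneg _) (abs_nonneg _)]
      have : |b| ^ (p - 2) ≠ 0 := (Real.rpow_pos_of_pos hbpos _).ne'
      field_simp
    have h1 : Jp p a - Jp p b = Jp p b * (Jp p (a / b) - 1) := by rw [hhom]; ring
    have h2 : |a - b| = |b| * |a / b - 1| := by
      rw [← abs_mul]; congr 1; field_simp
    rw [h1, abs_mul, abs_Jp hp, h2, Real.mul_rpow (abs_nonneg _) (abs_nonneg _)]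
    have := mul_le_mul_of_nonneg_left (key (a / b)) (Real.rpow_nonneg (abs_nonneg b) (p - 1))
    linarith

/-- The truncation of `t` to `[0, 1]`. -/
def trunc (t : ℝ) : ℝ := min (max t 0) 1

theorem continuous_trunc : Continuous trunc := by unfold trunc; fun_prop

theorem trunc_nonneg (t : ℝ) : 0 ≤ trunc t := le_min (le_max_right _ _) zero_le_one

theorem trunc_le_one (t : ℝ) : trunc t ≤ 1 := min_le_right _ _

theorem trunc_le_self_of_nonneg {t : ℝ} (h : 0 ≤ t) : trunc t ≤ t :=
  (min_le_left _ _).trans (max_le le_rfl h)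

theorem trunc_of_nonpos {t : ℝ} (h : t ≤ 0) : trunc t = 0 := by simp [trunc, h]

theorem pos_of_trunc_ne_zero {t : ℝ} (h : trunc t ≠ 0) : 0 < t := by
  by_contra! h'
  exact h (trunc_of_nonpos h')

theorem trunc_between (t t' : ℝ) : Between (trunc t - trunc t') (t - t') := by
  unfold Between trunc
  rcases le_total t t' with h | h
  · right
    constructor <;> grind
  · left
    constructor <;> grind

/-! ### The group, the Korányi norm and left translations -/

variable {N : ℕ}

theorem hmul_zero (a : Heis N) : hmul a 0 = a := by
  ext <;> simp [hmul]

theorem zero_hmul (a : Heis N) : hmul 0 a = a := by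
  ext <;> simp [hmul]

theorem hinv_hmul_cancel (a x : Heis N) : hmul (hinv a) (hmul a x) = x := by
  rw [← hmul_assoc, hinv_hmul, zero_hmul]

theorem hmul_hinv_cancel (a x : Heis N) : hmul a (hmul (hinv a) x) = x := by
  rw [← hmul_assoc, hmul_hinv, zero_hmul]

theorem hinv_hinv (a : Heis N) : hinv (hinv a) = a := neg_neg a

theorem hinv_hmul_rev (a b : Heis N) : hinv (hmul a b) = hmul (hinv b) (hinv a) := by
  ext <;> (simp [hmul, hinv, real_inner_comm]; try ring)

theorem continuous_hmul : Continuous fun z : Heis N × Heis N => hmul z.1 z.2 := by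
  unfold hmul; fun_prop

theorem continuous_hmul_left (a : Heis N) : Continuous (hmul a) :=
  continuous_hmul.comp (Continuous.prodMk_right a)

theorem contDiff_hmul {n : WithTop ℕ∞} :
    ContDiff ℝ n fun z : Heis N × Heis N => hmul z.1 z.2 := by
  unfold hmul
  have h1 : ContDiff ℝ n fun z : Heis N × Heis N => inner ℝ z.1.2.1 z.2.1 :=
    ContDiff.inner ℝ (by fun_prop) (by fun_prop)
  have h2 : ContDiff ℝ n fun z : Heis N × Heis N => inner ℝ z.1.1 z.2.2.1 :=
    ContDiff.inner ℝ (by fun_prop) (by fun_prop)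
  fun_prop

theorem continuous_hinv : Continuous (hinv : Heis N → Heis N) := continuous_neg

theorem koranyi_nonneg (ξ : Heis N) : 0 ≤ koranyi ξ := by unfold koranyi; positivity

theorem koranyi_hinv (ξ : Heis N) : koranyi (hinv ξ) = koranyi ξ := by simp [koranyi, hinv]

theorem koranyi_pow_four (ξ : Heis N) :
    koranyi ξ ^ 4 = (‖ξ.1‖ ^ 2 + ‖ξ.2.1‖ ^ 2) ^ 2 + ξ.2.2 ^ 2 := by
  unfold koranyi
  rw [← Real.rpow_natCast, ← Real.rpow_mul (by positivity)]
  norm_num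

theorem continuous_koranyi : Continuous (koranyi : Heis N → ℝ) := by
  unfold koranyi
  exact Continuous.rpow_const (by fun_prop) fun _ => Or.inr (by norm_num)

theorem norm_fst_le_koranyi (ξ : Heis N) : ‖ξ.1‖ ≤ koranyi ξ := by
  refine le_of_pow_le_pow_left₀ (n := 4) (by norm_num) (koranyi_nonneg ξ) ?_
  rw [koranyi_pow_four]
  nlinarith [sq_nonneg ‖ξ.1‖, sq_nonneg ‖ξ.2.1‖, sq_nonneg ξ.2.2,
    mul_nonneg (sq_nonneg ‖ξ.1‖) (sq_nonneg ‖ξ.2.1‖)]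

theorem norm_snd_fst_le_koranyi (ξ : Heis N) : ‖ξ.2.1‖ ≤ koranyi ξ := by
  refine le_of_pow_le_pow_left₀ (n := 4) (by norm_num) (koranyi_nonneg ξ) ?_
  rw [koranyi_pow_four]
  nlinarith [sq_nonneg ‖ξ.1‖, sq_nonneg ‖ξ.2.1‖, sq_nonneg ξ.2.2,
    mul_nonneg (sq_nonneg ‖ξ.1‖) (sq_nonneg ‖ξ.2.1‖)]

theorem abs_snd_snd_le_koranyi_sq (ξ : Heis N) : |ξ.2.2| ≤ koranyi ξ ^ 2 := by
  refine abs_le_of_sq_le_sq ?_ (by positivity)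
  rw [← pow_mul, koranyi_pow_four]
  nlinarith [sq_nonneg (‖ξ.1‖ ^ 2 + ‖ξ.2.1‖ ^ 2)]

theorem eq_zero_of_koranyi_eq_zero {ξ : Heis N} (h : koranyi ξ = 0) : ξ = 0 := by
  have h1 := norm_fst_le_koranyi ξ
  have h2 := norm_snd_fst_le_koranyi ξ
  have h3 := abs_snd_snd_le_koranyi_sq ξ
  rw [h] at h1 h2 h3
  have h1' : ξ.1 = 0 := norm_le_zero_iff.1 h1
  have h2' : ξ.2.1 = 0 := norm_le_zero_iff.1 h2
  have h3' : ξ.2.2 = 0 := abs_nonpos_iff.1 (by simpa using h3)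
  exact Prod.ext h1' (Prod.ext h2' h3')

theorem hdist_nonneg (ξ η : Heis N) : 0 ≤ hdist ξ η := koranyi_nonneg _

theorem hdist_eq_koranyi (ξ η : Heis N) : hdist ξ η = koranyi (hmul (hinv ξ) η) := by
  rw [← koranyi_hinv, hinv_hmul_rev, hinv_hinv, hdist]

theorem hdist_comm (ξ η : Heis N) : hdist ξ η = hdist η ξ := hdist_eq_koranyi ξ η

theorem hdist_hmul (a ξ η : Heis N) : hdist (hmul a ξ) (hmul a η) = hdist ξ η := by
  rw [hdist, hinv_hmul_rev, hmul_assoc, hinv_hmul_cancel, hdist]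

theorem continuous_hdist : Continuous fun z : Heis N × Heis N => hdist z.1 z.2 :=
  continuous_koranyi.comp (continuous_hmul.comp
    ((continuous_hinv.comp continuous_snd).prodMk continuous_fst))

theorem eq_of_hdist_eq_zero {ξ η : Heis N} (h : hdist ξ η = 0) : ξ = η := by
  have h1 := eq_zero_of_koranyi_eq_zero h
  have h2 := hmul_hinv_cancel η ξ
  rw [h1, hmul_zero] at h2
  exact h2.symm

/-- On bounded sets the Euclidean distance is controlled by the distance `hdist`. -/
theorem norm_sub_le_hdist {R : ℝ} {ξ η : Heis N} (hξ : ‖ξ‖ ≤ R) (h : hdist ξ η ≤ 1) :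
    ‖ξ - η‖ ≤ (1 + 4 * R) * hdist ξ η := by
  set ζ := hmul (hinv ξ) η with hζ
  have hd : hdist ξ η = koranyi ζ := hdist_eq_koranyi ξ η
  have hη : η = hmul ξ ζ := (hmul_hinv_cancel ξ η).symm
  rw [hd] at h ⊢
  have hR : 0 ≤ R := (norm_nonneg ξ).trans hξ
  have h0 := koranyi_nonneg ζ
  have h1 := norm_fst_le_koranyi ζ
  have h2 := norm_snd_fst_le_koranyi ζ
  have h3 := abs_snd_snd_le_koranyi_sq ζ
  have hx : ‖ξ.1‖ ≤ R := (norm_fst_le ξ).trans hξ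
  have hy : ‖ξ.2.1‖ ≤ R := ((norm_fst_le ξ.2).trans (norm_snd_le ξ)).trans hξ
  have i1 : |inner ℝ ξ.2.1 ζ.1| ≤ R * koranyi ζ :=
    (abs_real_inner_le_norm _ _).trans (mul_le_mul hy h1 (norm_nonneg _) hR)
  have i2 : |inner ℝ ξ.1 ζ.2.1| ≤ R * koranyi ζ :=
    (abs_real_inner_le_norm _ _).trans (mul_le_mul hx h2 (norm_nonneg _) hR)
  have hle : koranyi ζ ≤ (1 + 4 * R) * koranyi ζ := by nlinarith
  rw [norm_sub_rev, hη, Prod.norm_def, Prod.norm_def]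
  refine max_le ?_ (max_le ?_ ?_)
  · simpa [hmul] using h1.trans hle
  · simpa [hmul] using h2.trans hle
  · have : (hmul ξ ζ - ξ).2.2 = ζ.2.2 + 2 * inner ℝ ξ.2.1 ζ.1 - 2 * inner ℝ ξ.1 ζ.2.1 := by
      simp [hmul]; ring
    rw [this, Real.norm_eq_abs]
    rw [abs_le] at *
    constructor <;> nlinarith

theorem measurePreserving_hmul (a : Heis N) :
    MeasurePreserving (hmul a) (volume : Measure (Heis N)) volume := by
  have hin : ∀ x : EuclideanSpace ℝ (Fin N), MeasurePreserving
      (fun w : EuclideanSpace ℝ (Fin N) × ℝ => (a.2.1 + w.1,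
        a.2.2 + w.2 + 2 * inner ℝ a.2.1 x - 2 * inner ℝ a.1 w.1)) volume volume := by
    intro x
    refine (measurePreserving_add_left volume a.2.1).skew_product
      (g := fun (y : EuclideanSpace ℝ (Fin N)) (t : ℝ) =>
        a.2.2 + t + 2 * inner ℝ a.2.1 x - 2 * inner ℝ a.1 y) ?_ ?_
    · exact Continuous.measurable (by unfold Function.uncurry; fun_prop)
    · refine Filter.Eventually.of_forall fun y => ?_
      have : (fun t : ℝ => a.2.2 + t + 2 * inner ℝ a.2.1 x - 2 * inner ℝ a.1 y)
          = fun t => (a.2.2 + 2 * inner ℝ a.2.1 x - 2 * inner ℝ a.1 y) + t := by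
        funext t; ring
      rw [this]
      exact (measurePreserving_add_left volume _).map_eq
  exact (measurePreserving_add_left volume a.1).skew_product
    (g := fun (x : EuclideanSpace ℝ (Fin N)) (w : EuclideanSpace ℝ (Fin N) × ℝ) => (a.2.1 + w.1,
        a.2.2 + w.2 + 2 * inner ℝ a.2.1 x - 2 * inner ℝ a.1 w.1))
    (Continuous.measurable (by unfold Function.uncurry; fun_prop))
    (Filter.Eventually.of_forall fun x => (hin x).map_eq)

theorem measurePreserving_hmul_hinv (a : Heis N) :
    MeasurePreserving (fun y => hmul a (hinv y)) (volume : Measure (Heis N)) volume :=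
  (measurePreserving_hmul a).comp ((Measure.measurePreserving_neg volume).prod
    ((Measure.measurePreserving_neg volume).prod (Measure.measurePreserving_neg volume)))

theorem volume_koranyi_le (N : ℕ) : ∃ c : ENNReal, c ≠ ⊤ ∧ ∀ r : ℝ, 0 ≤ r →
    volume {ξ : Heis N | koranyi ξ ≤ r} ≤ c * ENNReal.ofReal (r ^ (2 * N + 2)) := by
  set b := volume (Metric.ball (0 : EuclideanSpace ℝ (Fin N)) 1) with hb
  have hbt : b ≠ ⊤ := measure_ball_lt_top.ne
  refine ⟨2 * (b * b), by finiteness, fun r hr => ?_⟩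
  have hsub : {ξ : Heis N | koranyi ξ ≤ r} ⊆
      Metric.closedBall (0 : EuclideanSpace ℝ (Fin N)) r ×ˢ
        (Metric.closedBall (0 : EuclideanSpace ℝ (Fin N)) r ×ˢ Set.Icc (-(r ^ 2)) (r ^ 2)) := by
    intro ξ hξ
    have hξ' : koranyi ξ ≤ r := hξ
    refine ⟨?_, ?_, ?_⟩
    · simpa using (norm_fst_le_koranyi ξ).trans hξ'
    · simpa using (norm_snd_fst_le_koranyi ξ).trans hξ'
    · rw [Set.mem_Icc, ← abs_le]
      exact (abs_snd_snd_le_koranyi_sq ξ).trans (by gcongr; exact koranyi_nonneg ξ)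
  refine (measure_mono hsub).trans (le_of_eq ?_)
  rw [Measure.volume_eq_prod, Measure.prod_prod, Measure.volume_eq_prod, Measure.prod_prod,
    Measure.addHaar_closedBall _ _ hr, ← hb, Real.volume_Icc, finrank_euclideanSpace_fin]
  have h2 : ENNReal.ofReal (r ^ 2 - -(r ^ 2)) = 2 * ENNReal.ofReal (r ^ 2) := by
    rw [sub_neg_eq_add, ← two_mul, ENNReal.ofReal_mul (by norm_num)]; norm_num
  have h3 : ENNReal.ofReal (r ^ (2 * N + 2))
      = ENNReal.ofReal (r ^ N) * ENNReal.ofReal (r ^ N) * ENNReal.ofReal (r ^ 2) := by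
    rw [← ENNReal.ofReal_mul (by positivity), ← ENNReal.ofReal_mul (by positivity)]
    congr 1; ring
  rw [h2, h3]; ring

/-- A function with values at most `B n` on Korányi shells of radius `R n` is integrable when
`∑ B n (R n)^Q` converges. -/
theorem lintegral_lt_top_of_shells {F : Heis N → ENNReal} {R B : ℕ → ℝ}
    (hR : ∀ n, 0 ≤ R n) (hB : ∀ n, 0 ≤ B n)
    (h : ∀ ξ, F ξ = 0 ∨ ∃ n, koranyi ξ ≤ R n ∧ F ξ ≤ ENNReal.ofReal (B n))
    (hsum : Summable fun n => B n * R n ^ (2 * N + 2)) : ∫⁻ ξ, F ξ < ⊤ := by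
  obtain ⟨c, hc, hvol⟩ := volume_koranyi_le N
  have hm : ∀ n, MeasurableSet {ξ : Heis N | koranyi ξ ≤ R n} := fun n =>
    (isClosed_le continuous_koranyi continuous_const).measurableSet
  calc ∫⁻ ξ, F ξ
      ≤ ∫⁻ ξ, ∑' n, {ξ : Heis N | koranyi ξ ≤ R n}.indicator
          (fun _ => ENNReal.ofReal (B n)) ξ := by
        refine lintegral_mono fun ξ => ?_
        rcases h ξ with h0 | ⟨n, hn, hF⟩
        · rw [h0]; exact zero_le
        · refine le_trans ?_ (ENNReal.le_tsum n)
          rwa [Set.indicator_of_mem (by exact hn)]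
    _ = ∑' n, ENNReal.ofReal (B n) * volume {ξ : Heis N | koranyi ξ ≤ R n} := by
        rw [lintegral_tsum fun n => (measurable_const.indicator (hm n)).aemeasurable]
        congr 1; funext n
        rw [lintegral_indicator_const (hm n)]
    _ ≤ ∑' n, c * ENNReal.ofReal (B n * R n ^ (2 * N + 2)) := by
        refine ENNReal.tsum_le_tsum fun n => ?_
        rw [ENNReal.ofReal_mul (hB n), mul_left_comm]
        gcongr
        exact hvol _ (hR n)
    _ = c * ∑' n, ENNReal.ofReal (B n * R n ^ (2 * N + 2)) := ENNReal.tsum_mul_left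
    _ < ⊤ := by
        rw [← ENNReal.ofReal_tsum_of_nonneg
          (fun n => mul_nonneg (hB n) (pow_nonneg (hR n) _)) hsum]
        exact ENNReal.mul_lt_top hc.lt_top ENNReal.ofReal_lt_top

/-- The kernel weighted by `min (1, |ξ|)^p` is integrable: this is where `0 < s < 1` enters. -/
theorem lintegral_min_rpow_kernel_lt_top {s p : ℝ} (hs0 : 0 < s) (hs1 : s < 1) (hp : 1 < p) :
    ∫⁻ ξ : Heis N, ENNReal.ofReal (min 1 (koranyi ξ) ^ p)
      * ENNReal.ofReal (koranyi ξ ^ (homDim N + s * p))⁻¹ < ⊤ := by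
  have hp0 : p ≠ 0 := by linarith
  have hsp : 0 < s * p := by positivity
  have hQ : 0 < homDim N := by unfold homDim; positivity
  have hQN : (((2 * N + 2 : ℕ) : ℝ)) = homDim N := by unfold homDim; push_cast; ring
  set q := homDim N + s * p with hq
  have hq0 : 0 < q := by linarith
  set F : Heis N → ENNReal := fun ξ => ENNReal.ofReal (min 1 (koranyi ξ) ^ p)
      * ENNReal.ofReal (koranyi ξ ^ q)⁻¹ with hF
  set S : Set (Heis N) := {ξ | koranyi ξ ≤ 1} with hS
  have hSm : MeasurableSet S := (isClosed_le continuous_koranyi continuous_const).measurableSet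
  change ∫⁻ ξ, F ξ < ⊤
  rw [← lintegral_add_compl F hSm, ← lintegral_indicator hSm, ← lintegral_indicator hSm.compl]
  refine ENNReal.add_lt_top.2 ⟨?_, ?_⟩
  · refine lintegral_lt_top_of_shells (R := fun n => (1 / 2) ^ n)
      (B := fun n => ((1 / 2 : ℝ) ^ n) ^ p * (((1 / 2 : ℝ) ^ (n + 1)) ^ q)⁻¹)
      (fun n => by positivity) (fun n => by positivity) (fun ξ => ?_) ?_
    · by_cases hξ : ξ ∈ S
      · rcases (koranyi_nonneg ξ).eq_or_lt with h0 | h0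
        · left
          rw [Set.indicator_of_mem hξ, hF]
          simp [← h0, Real.zero_rpow hp0]
        · right
          obtain ⟨n, hn1, hn2⟩ := exists_nat_pow_near_of_lt_one (x := koranyi ξ) h0 hξ
            (y := (1 / 2 : ℝ)) (by norm_num) (by norm_num)
          refine ⟨n, hn2, ?_⟩
          rw [Set.indicator_of_mem hξ, hF, ENNReal.ofReal_mul (by positivity)]
          refine mul_le_mul' (ENNReal.ofReal_le_ofReal ?_) (ENNReal.ofReal_le_ofReal ?_)
          · rw [min_eq_right (by exact hξ)]
            gcongr
          · gcongr
      · left; exact Set.indicator_of_notMem hξ _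
    · have hr : Summable fun n : ℕ => ((1 / 2 : ℝ) ^ (-q)) * ((1 / 2 : ℝ) ^ (p - s * p)) ^ n := by
        refine (summable_geometric_of_lt_one (by positivity) ?_).mul_left _
        exact Real.rpow_lt_one (by norm_num) (by norm_num) (by nlinarith)
      refine hr.congr fun n => ?_
      have h2 : (0 : ℝ) < 1 / 2 := by norm_num
      simp only [← Real.rpow_natCast, ← Real.rpow_mul h2.le, ← Real.rpow_neg h2.le,
        ← Real.rpow_add h2]
      congr 1
      rw [hQN, hq]; push_cast; ring
  · refine lintegral_lt_top_of_shells (R := fun n => 2 ^ (n + 1))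
      (B := fun n => (((2 : ℝ) ^ n) ^ q)⁻¹)
      (fun n => by positivity) (fun n => by positivity) (fun ξ => ?_) ?_
    · by_cases hξ : ξ ∈ S
      · left; exact Set.indicator_of_notMem (by simpa using hξ) _
      · right
        have h1 : 1 < koranyi ξ := not_le.1 hξ
        obtain ⟨n, hn1, hn2⟩ := exists_nat_pow_near h1.le (y := (2 : ℝ)) (by norm_num)
        refine ⟨n, hn2.le, ?_⟩
        rw [Set.indicator_of_mem (by exact hξ), hF]
        simp only [min_eq_left h1.le, Real.one_rpow, ENNReal.ofReal_one, one_mul]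
        refine ENNReal.ofReal_le_ofReal ?_
        gcongr
    · have hr : Summable fun n : ℕ => ((2 : ℝ) ^ (homDim N)) * ((2 : ℝ) ^ (-(s * p))) ^ n := by
        refine (summable_geometric_of_lt_one (by positivity) ?_).mul_left _
        exact Real.rpow_lt_one_of_one_lt_of_neg (by norm_num) (by linarith)
      refine hr.congr fun n => ?_
      have h2 : (0 : ℝ) < 2 := by norm_num
      simp only [← Real.rpow_natCast, ← Real.rpow_mul h2.le, ← Real.rpow_neg h2.le,
        ← Real.rpow_add h2]
      congr 1
      rw [hQN, hq]; push_cast; ring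

/-! ### The energy measure and functions of finite energy -/

variable {s p : ℝ}

/-- The increment `(x, y) ↦ g x - g y`. -/
def incr (g : Heis N → ℝ) (z : Heis N × Heis N) : ℝ := g z.1 - g z.2

/-- The density `|y⁻¹ ∘ x|^(-(Q + s p))`. -/
def kernel (s p : ℝ) (z : Heis N × Heis N) : ENNReal :=
  ENNReal.ofReal (hdist z.1 z.2 ^ (homDim N + s * p))⁻¹

/-- The measure `|y⁻¹ ∘ x|^(-(Q + s p)) dx dy`, for which the Gagliardo seminorm of `g` is the
`L^p` norm of its increment. It has infinite mass near the diagonal. -/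
def energyMeasure (N : ℕ) (s p : ℝ) : Measure (Heis N × Heis N) :=
  ((volume : Measure (Heis N)).prod volume).withDensity (kernel s p)

theorem measurable_hdist : Measurable fun z : Heis N × Heis N => hdist z.1 z.2 :=
  continuous_hdist.measurable

theorem measurable_kernel : Measurable (kernel (N := N) s p) :=
  ((measurable_hdist.pow_const _).inv).ennreal_ofReal

theorem measurable_incr {g : Heis N → ℝ} (hg : Measurable g) : Measurable (incr g) :=
  (hg.comp measurable_fst).sub (hg.comp measurable_snd)

theorem energyMeasure_ac :
    energyMeasure N s p ≪ (volume : Measure (Heis N)).prod volume :=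
  withDensity_absolutelyContinuous _ _

theorem lintegral_energyMeasure {F : Heis N × Heis N → ENNReal} (hF : Measurable F) :
    ∫⁻ z, F z ∂(energyMeasure N s p)
      = ∫⁻ z, kernel s p z * F z ∂((volume : Measure (Heis N)).prod volume) := by
  rw [energyMeasure, lintegral_withDensity_eq_lintegral_mul _ measurable_kernel hF]
  rfl

theorem measurePreserving_energyMeasure {T : Heis N × Heis N → Heis N × Heis N}
    (hT : MeasurePreserving T ((volume : Measure (Heis N)).prod volume)
      ((volume : Measure (Heis N)).prod volume))
    (hk : ∀ z, kernel s p (T z) = kernel s p z) :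
    MeasurePreserving T (energyMeasure N s p) (energyMeasure N s p) := by
  refine ⟨hT.measurable, Measure.ext fun A hA => ?_⟩
  rw [Measure.map_apply hT.measurable hA, energyMeasure,
    withDensity_apply _ (hT.measurable hA), withDensity_apply _ hA,
    ← hT.setLIntegral_comp_preimage hA measurable_kernel]
  simp only [hk]

theorem measurePreserving_hmul_prod (a : Heis N) :
    MeasurePreserving (fun z : Heis N × Heis N => (hmul a z.1, hmul a z.2))
      ((volume : Measure (Heis N)).prod volume) ((volume : Measure (Heis N)).prod volume) :=
  (measurePreserving_hmul a).prod (measurePreserving_hmul a)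

theorem measurePreserving_hmul_energyMeasure (a : Heis N) :
    MeasurePreserving (fun z : Heis N × Heis N => (hmul a z.1, hmul a z.2))
      (energyMeasure N s p) (energyMeasure N s p) :=
  measurePreserving_energyMeasure (measurePreserving_hmul_prod a) fun z => by
    simp only [kernel, hdist_hmul]

theorem measurePreserving_swap_energyMeasure :
    MeasurePreserving (Prod.swap : Heis N × Heis N → Heis N × Heis N)
      (energyMeasure N s p) (energyMeasure N s p) :=
  measurePreserving_energyMeasure Measure.measurePreserving_swap fun z => by
    simp only [kernel, Prod.fst_swap, Prod.snd_swap, hdist_comm]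

/-- By left invariance, functions of the distance integrate out. -/
theorem lintegral_energyMeasure_fst {w : Heis N → ENNReal} (hw : Measurable w)
    {G : ℝ → ENNReal} (hG : Measurable G) :
    ∫⁻ z, w z.1 * G (hdist z.1 z.2) ∂(energyMeasure N s p)
      = (∫⁻ x, w x) * ∫⁻ ξ : Heis N, G (koranyi ξ)
          * ENNReal.ofReal (koranyi ξ ^ (homDim N + s * p))⁻¹ := by
  have hm : Measurable fun z : Heis N × Heis N => w z.1 * G (hdist z.1 z.2) :=
    (hw.comp measurable_fst).mul (hG.comp measurable_hdist)
  have hm' : Measurable fun ξ : Heis N => G (koranyi ξ)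
      * ENNReal.ofReal (koranyi ξ ^ (homDim N + s * p))⁻¹ :=
    (hG.comp continuous_koranyi.measurable).mul
      ((continuous_koranyi.measurable.pow_const _).inv).ennreal_ofReal
  rw [lintegral_energyMeasure hm,
    lintegral_prod (fun z => kernel s p z * (w z.1 * G (hdist z.1 z.2)))
      (measurable_kernel.mul hm).aemeasurable, ← lintegral_mul_const _ hw]
  refine lintegral_congr fun x => ?_
  have h1 := (measurePreserving_hmul (hinv x)).lintegral_comp hm'
  have hm2 := hm'.comp (measurePreserving_hmul (hinv x)).measurable
  simp only [Function.comp_def] at hm2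
  rw [← h1, ← lintegral_const_mul _ hm2]
  refine lintegral_congr fun y => ?_
  simp only [kernel, hdist_eq_koranyi]
  ring

theorem lintegral_energyMeasure_snd {w : Heis N → ENNReal} (hw : Measurable w)
    {G : ℝ → ENNReal} (hG : Measurable G) :
    ∫⁻ z, w z.2 * G (hdist z.1 z.2) ∂(energyMeasure N s p)
      = (∫⁻ x, w x) * ∫⁻ ξ : Heis N, G (koranyi ξ)
          * ENNReal.ofReal (koranyi ξ ^ (homDim N + s * p))⁻¹ := by
  rw [← lintegral_energyMeasure_fst hw hG]
  have hm : Measurable fun z : Heis N × Heis N => w z.1 * G (hdist z.1 z.2) :=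
    (hw.comp measurable_fst).mul (hG.comp measurable_hdist)
  rw [← measurePreserving_swap_energyMeasure.lintegral_comp hm]
  refine lintegral_congr fun z => ?_
  simp only [Prod.fst_swap, Prod.snd_swap, hdist_comm]

/-- The indicator of `[d, ∞)`, used to cut off the diagonal. -/
def farInd (d : ℝ) : ℝ → ENNReal := (Set.Ici d).indicator fun _ => 1

theorem measurable_farInd (d : ℝ) : Measurable (farInd d) :=
  measurable_const.indicator measurableSet_Ici

theorem lintegral_farInd_kernel_lt_top (hs0 : 0 < s) (hs1 : s < 1) (hp : 1 < p) {d : ℝ}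
    (hd : 0 < d) : ∫⁻ ξ : Heis N, farInd d (koranyi ξ)
      * ENNReal.ofReal (koranyi ξ ^ (homDim N + s * p))⁻¹ < ⊤ := by
  have h := lintegral_min_rpow_kernel_lt_top (N := N) hs0 hs1 hp
  set m := min 1 d with hm
  have hm0 : 0 < m := lt_min one_pos hd
  refine lt_of_le_of_lt ?_ (ENNReal.mul_lt_top (ENNReal.ofReal_lt_top (r := (m ^ p)⁻¹)) h)
  rw [← lintegral_const_mul']
  · refine lintegral_mono fun ξ => ?_
    rw [← mul_assoc]
    gcongr
    unfold farInd
    by_cases hξ : koranyi ξ ∈ Set.Ici d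
    · rw [Set.indicator_of_mem hξ, ← ENNReal.ofReal_mul (by positivity), ENNReal.one_le_ofReal,
        inv_mul_eq_div, one_le_div (by positivity)]
      exact Real.rpow_le_rpow hm0.le (min_le_min le_rfl hξ) (by linarith)
    · rw [Set.indicator_of_notMem hξ]; exact zero_le
  · exact ENNReal.ofReal_ne_top

theorem lintegral_far_fst_lt_top (hs0 : 0 < s) (hs1 : s < 1) (hp : 1 < p) {d : ℝ}
    (hd : 0 < d) {w : Heis N → ENNReal} (hw : Measurable w) (hwt : ∫⁻ x, w x < ⊤) :
    ∫⁻ z, w z.1 * farInd d (hdist z.1 z.2) ∂(energyMeasure N s p) < ⊤ := by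
  rw [lintegral_energyMeasure_fst hw (measurable_farInd d)]
  exact ENNReal.mul_lt_top hwt (lintegral_farInd_kernel_lt_top hs0 hs1 hp hd)

/-- A measurable representative of an element of `HW^{s,p}(ℍ^N)`. -/
structure FiniteEnergy (s p : ℝ) (g : Heis N → ℝ) : Prop where
  measurable : Measurable g
  memLp : MemLp g (ENNReal.ofReal p) volume
  incr_memLp : MemLp (incr g) (ENNReal.ofReal p) (energyMeasure N s p)

theorem eLpNorm_lt_top_iff_lintegral {α : Type*} [MeasurableSpace α] {μ : Measure α} (hp : 1 < p)
    {F : α → ℝ} :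
    eLpNorm F (ENNReal.ofReal p) μ < ⊤ ↔ ∫⁻ x, ‖F x‖ₑ ^ p ∂μ < ⊤ := by
  rw [eLpNorm_lt_top_iff_lintegral_rpow_enorm_lt_top (by simp; linarith) ENNReal.ofReal_ne_top,
    ENNReal.toReal_ofReal (by linarith)]

theorem MemHW.incr_memLp {ω : Set (Heis N)} {g : Heis N → ℝ} (hp : 1 < p)
    (hω : MeasurableSet ω) (hg : Measurable g) (h : MemHW s p ω g) :
    MemLp (incr g) (ENNReal.ofReal p) ((energyMeasure N s p).restrict (ω ×ˢ ω)) := by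
  refine ⟨(measurable_incr hg).aestronglyMeasurable, ?_⟩
  have h2 := h.2.2
  rw [eLpNorm_lt_top_iff_lintegral hp, Measure.prod_restrict] at h2
  rw [eLpNorm_lt_top_iff_lintegral hp, energyMeasure, restrict_withDensity (hω.prod hω),
    lintegral_withDensity_eq_lintegral_mul _ measurable_kernel
      ((measurable_incr hg).enorm.pow_const _)]
  refine lt_of_eq_of_lt (lintegral_congr fun z => ?_) h2
  have hp0 : 0 < p := by linarith
  simp only [Pi.mul_apply, kernel, incr]
  have hh := hdist_nonneg z.1 z.2
  rw [Real.enorm_eq_ofReal_abs, Real.enorm_eq_ofReal_abs,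
    ENNReal.ofReal_rpow_of_nonneg (abs_nonneg _) hp0.le,
    ENNReal.ofReal_rpow_of_nonneg (abs_nonneg _) hp0.le,
    ← ENNReal.ofReal_mul (by positivity)]
  congr 1
  rw [abs_div, abs_abs, abs_of_nonneg (by positivity : 0 ≤ hdist z.1 z.2 ^ (s + homDim N / p)),
    Real.div_rpow (abs_nonneg _) (by positivity), ← Real.rpow_mul hh]
  have : (s + homDim N / p) * p = homDim N + s * p := by field_simp; ring
  rw [this]; ring

theorem MemHW.finiteEnergy {g : Heis N → ℝ} (hp : 1 < p) (hg : Measurable g)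
    (h : MemHW s p Set.univ g) : FiniteEnergy s p g := by
  refine ⟨hg, by simpa using h.1, ?_⟩
  simpa using h.incr_memLp hp MeasurableSet.univ hg

theorem FiniteEnergy.sub {g g' : Heis N → ℝ} (h : FiniteEnergy s p g) (h' : FiniteEnergy s p g') :
    FiniteEnergy s p (fun x => g x - g' x) := by
  refine ⟨h.measurable.sub h'.measurable, h.memLp.sub h'.memLp, ?_⟩
  have : incr (fun x => g x - g' x) = incr g - incr g' := by
    funext z; simp only [incr, Pi.sub_apply]; ring
  rw [this]
  exact h.incr_memLp.sub h'.incr_memLp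

theorem FiniteEnergy.add {g g' : Heis N → ℝ} (h : FiniteEnergy s p g) (h' : FiniteEnergy s p g') :
    FiniteEnergy s p (fun x => g x + g' x) := by
  refine ⟨h.measurable.add h'.measurable, h.memLp.add h'.memLp, ?_⟩
  have : incr (fun x => g x + g' x) = incr g + incr g' := by
    funext z; simp only [incr, Pi.add_apply]; ring
  rw [this]
  exact h.incr_memLp.add h'.incr_memLp

theorem FiniteEnergy.inf {g g' : Heis N → ℝ} (h : FiniteEnergy s p g) (h' : FiniteEnergy s p g') :
    FiniteEnergy s p (fun x => min (g x) (g' x)) := by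
  refine ⟨h.measurable.min h'.measurable, ?_, ?_⟩
  · refine (h.memLp.norm.add h'.memLp.norm).mono
      (h.measurable.min h'.measurable).aestronglyMeasurable (.of_forall fun x => ?_)
    simp only [Pi.add_apply, Real.norm_eq_abs]
    grind
  · refine (h.incr_memLp.norm.add h'.incr_memLp.norm).mono
      (measurable_incr (h.measurable.min h'.measurable)).aestronglyMeasurable
      (.of_forall fun z => ?_)
    simp only [Pi.add_apply, Real.norm_eq_abs, incr]
    grind

theorem FiniteEnergy.comp_hmul {g : Heis N → ℝ} (h : FiniteEnergy s p g) (a : Heis N) :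
    FiniteEnergy s p (fun x => g (hmul a x)) :=
  ⟨h.measurable.comp (continuous_hmul_left a).measurable,
    h.memLp.comp_measurePreserving (measurePreserving_hmul a),
    h.incr_memLp.comp_measurePreserving (measurePreserving_hmul_energyMeasure a)⟩

/-- A Lipschitz function of bounded support has increments bounded by `C min (1, hdist)`. -/
theorem abs_incr_le_of_lipschitz {b : Heis N → ℝ} {K : NNReal} (hb : LipschitzWith K b)
    (hb1 : ∀ x, |b x| ≤ 1) {R : ℝ} (hR : ∀ x, R < ‖x‖ → b x = 0) :
    ∃ C : ℝ, 0 ≤ C ∧ ∀ z : Heis N × Heis N, |incr b z| ≤ C * min 1 (hdist z.1 z.2) := by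
  set R' := max R 0
  have hR' : 0 ≤ R' := le_max_right _ _
  refine ⟨2 + K * (1 + 4 * R'), by positivity, fun z => ?_⟩
  have hh := hdist_nonneg z.1 z.2
  have hL : |incr b z| ≤ K * ‖z.1 - z.2‖ := by
    simpa [Real.dist_eq, dist_eq_norm, incr] using hb.dist_le_mul z.1 z.2
  have hK : 0 ≤ (K : ℝ) * (1 + 4 * R') := by positivity
  rcases le_total (hdist z.1 z.2) 1 with h | h
  · rw [min_eq_right h]
    by_cases h1 : ‖z.1‖ ≤ R'
    · have h2 := mul_le_mul_of_nonneg_left (norm_sub_le_hdist h1 h) K.2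
      change (K : ℝ) * _ ≤ (K : ℝ) * _ at h2
      nlinarith
    by_cases h2 : ‖z.2‖ ≤ R'
    · rw [hdist_comm] at h ⊢
      rw [norm_sub_rev] at hL
      have h3 := mul_le_mul_of_nonneg_left (norm_sub_le_hdist h2 h) K.2
      change (K : ℝ) * _ ≤ (K : ℝ) * _ at h3
      rw [hdist_comm] at hh
      nlinarith
    · have e1 := hR z.1 ((le_max_left _ _).trans_lt (not_le.1 h1))
      have e2 := hR z.2 ((le_max_left _ _).trans_lt (not_le.1 h2))
      rw [incr, e1, e2]
      simp only [sub_self, abs_zero]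
      positivity
  · rw [min_eq_left h, mul_one]
    have := (abs_sub (b z.1) (b z.2)).trans (add_le_add (hb1 _) (hb1 _))
    simp only [incr]
    linarith

/-- The increment of `b g` splits as `b(x) (g(x) - g(y)) + g(y) (b(x) - b(y))`, and the second term
is integrated in `x` first. -/
theorem FiniteEnergy.mul_lipschitz (hs0 : 0 < s) (hs1 : s < 1) (hp : 1 < p) {g b : Heis N → ℝ}
    (h : FiniteEnergy s p g) {K : NNReal} (hb : LipschitzWith K b)
    (hb1 : ∀ x, |b x| ≤ 1) {R : ℝ} (hR : ∀ x, R < ‖x‖ → b x = 0) :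
    FiniteEnergy s p (fun x => b x * g x) := by
  have hbm : Measurable b := hb.continuous.measurable
  have hm := hbm.mul h.measurable
  obtain ⟨C, hC, hinc⟩ := abs_incr_le_of_lipschitz hb hb1 hR
  have hle : ∀ (x : Heis N) (t : ℝ), |b x * t| ≤ |t| := fun x t => by
    rw [abs_mul]; exact mul_le_of_le_one_left (abs_nonneg _) (hb1 x)
  refine ⟨hm, h.memLp.mono hm.aestronglyMeasurable (.of_forall fun x => hle x _), ?_⟩
  have heq : incr (fun x => b x * g x)
      = (fun z => b z.1 * incr g z) + fun z => g z.2 * incr b z := by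
    funext z; simp only [incr, Pi.add_apply]; ring
  rw [heq]
  refine MemLp.add (h.incr_memLp.mono ((hbm.comp measurable_fst).mul
    (measurable_incr h.measurable)).aestronglyMeasurable (.of_forall fun z => hle _ _)) ?_
  refine ⟨((h.measurable.comp measurable_snd).mul (measurable_incr hbm)).aestronglyMeasurable, ?_⟩
  rw [eLpNorm_lt_top_iff_lintegral hp]
  have hG : Measurable fun t : ℝ => ENNReal.ofReal (min 1 t ^ p) :=
    ((measurable_const.min measurable_id).pow_const _).ennreal_ofReal
  have hw : Measurable fun x => ENNReal.ofReal (C ^ p) * ‖g x‖ₑ ^ p :=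
    (h.measurable.enorm.pow_const _).const_mul _
  refine lt_of_le_of_lt (b := ∫⁻ z, (ENNReal.ofReal (C ^ p) * ‖g z.2‖ₑ ^ p)
    * ENNReal.ofReal (min 1 (hdist z.1 z.2) ^ p) ∂(energyMeasure N s p)) ?_ ?_
  · refine lintegral_mono fun z => ?_
    have hh := hdist_nonneg z.1 z.2
    have hmin : 0 ≤ min 1 (hdist z.1 z.2) := le_min zero_le_one hh
    rw [enorm_mul, ENNReal.mul_rpow_of_nonneg _ _ (by linarith), mul_comm (ENNReal.ofReal _),
      mul_assoc, ← ENNReal.ofReal_mul (by positivity), ← Real.mul_rpow hC hmin,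
      ← ENNReal.ofReal_rpow_of_nonneg (by positivity) (by linarith : (0 : ℝ) ≤ p),
      Real.enorm_eq_ofReal_abs (incr b z)]
    gcongr
    exact hinc z
  · rw [lintegral_energyMeasure_snd hw hG]
    refine ENNReal.mul_lt_top ?_ (lintegral_min_rpow_kernel_lt_top hs0 hs1 hp)
    rw [lintegral_const_mul _ (h.measurable.enorm.pow_const _)]
    exact ENNReal.mul_lt_top ENNReal.ofReal_lt_top
      ((eLpNorm_lt_top_iff_lintegral hp).1 h.memLp.2)

/-- A compact set keeps a positive `hdist`-distance from the complement of a neighbourhood. -/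
theorem exists_le_hdist {K ω : Set (Heis N)} (hK : IsCompact K) (hω : IsOpen ω) (h : K ⊆ ω) :
    ∃ d : ℝ, 0 < d ∧ ∀ x ∈ K, ∀ y ∉ ω, d ≤ hdist x y := by
  obtain ⟨R, hR⟩ := hK.isBounded.exists_norm_le
  obtain ⟨ε, hε, hεω⟩ := hK.exists_thickening_subset_open hω h
  set R' := max R 0
  have hR' : 0 ≤ R' := le_max_right _ _
  refine ⟨min 1 (ε / (1 + 4 * R')), by positivity, fun x hx y hy => ?_⟩
  by_contra! hlt
  have h1 := norm_sub_le_hdist ((hR x hx).trans (le_max_left _ _ : R ≤ R'))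
    (hlt.le.trans (min_le_left _ _))
  have h2 : hdist x y < ε / (1 + 4 * R') := hlt.trans_le (min_le_right _ _)
  rw [lt_div_iff₀ (by positivity)] at h2
  refine hy (hεω (Metric.mem_thickening_iff.2 ⟨x, hx, ?_⟩))
  rw [dist_comm, dist_eq_norm]
  linarith

theorem memLp_far_fst (hs0 : 0 < s) (hs1 : s < 1) (hp : 1 < p) {d : ℝ} (hd : 0 < d)
    {w : Heis N → ℝ} (hw : Measurable w) (h : MemLp w (ENNReal.ofReal p) volume) :
    MemLp (fun z : Heis N × Heis N => w z.1 * (farInd d (hdist z.1 z.2)).toReal)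
      (ENNReal.ofReal p) (energyMeasure N s p) := by
  refine ⟨((hw.comp measurable_fst).mul ((measurable_farInd d).comp
    measurable_hdist).ennreal_toReal).aestronglyMeasurable, ?_⟩
  rw [eLpNorm_lt_top_iff_lintegral hp]
  refine lt_of_eq_of_lt (lintegral_congr fun z => ?_) (lintegral_far_fst_lt_top hs0 hs1 hp hd
    (hw.enorm.pow_const p) ((eLpNorm_lt_top_iff_lintegral hp).1 h.2))
  rw [enorm_mul, ENNReal.mul_rpow_of_nonneg _ _ (by linarith)]
  congr 1
  unfold farInd
  by_cases hz : hdist z.1 z.2 ∈ Set.Ici d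
  · simp [Set.indicator_of_mem hz]
  · simp [Set.indicator_of_notMem hz]; linarith

/-- Test functions of the form `trunc (r - v)`, for `r` of finite energy supported in a compact set
and `v ≥ 0` of locally finite energy, have finite energy. -/
theorem FiniteEnergy.trunc_sub (hs0 : 0 < s) (hs1 : s < 1) (hp : 1 < p) {r v : Heis N → ℝ}
    (hr : FiniteEnergy s p r) (hv : Measurable v) (hv0 : ∀ x, 0 ≤ v x)
    {K ω : Set (Heis N)} (hK : IsCompact K) (hω : IsOpen ω) (hKω : K ⊆ ω)
    (hrK : ∀ x ∉ K, r x = 0)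
    (hvω : MemLp (incr v) (ENNReal.ofReal p) ((energyMeasure N s p).restrict (ω ×ˢ ω))) :
    FiniteEnergy s p (fun x => trunc (r x - v x)) := by
  set φ : Heis N → ℝ := fun x => trunc (r x - v x) with hφ
  have hm : Measurable φ := continuous_trunc.measurable.comp (hr.measurable.sub hv)
  have hle : ∀ x, ‖φ x‖ ≤ ‖r x‖ := fun x => by
    rw [Real.norm_eq_abs, abs_of_nonneg (trunc_nonneg _), Real.norm_eq_abs]
    rcases le_total (r x - v x) 0 with h0 | h0
    · simp only [trunc_of_nonpos h0]; positivity
    · refine (trunc_le_self_of_nonneg h0).trans ?_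
      linarith [le_abs_self (r x), hv0 x]
  have hφK : ∀ x ∉ K, φ x = 0 := fun x hx => by
    have := hle x
    rw [hrK x hx, norm_zero] at this
    exact norm_le_zero_iff.1 this
  have hL : MemLp φ (ENNReal.ofReal p) volume :=
    hr.memLp.mono hm.aestronglyMeasurable (.of_forall hle)
  refine ⟨hm, hL, ?_⟩
  obtain ⟨d, hd, hdist⟩ := exists_le_hdist hK hω hKω
  have hA : MeasurableSet (ω ×ˢ ω) := hω.measurableSet.prod hω.measurableSet
  have h1 : MemLp ((ω ×ˢ ω).indicator fun z => ‖incr r z‖ + ‖incr v z‖) (ENNReal.ofReal p)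
      (energyMeasure N s p) := by
    rw [memLp_indicator_iff_restrict hA]
    exact (hr.incr_memLp.restrict _).norm.add hvω.norm
  have h2 := (memLp_far_fst (s := s) hs0 hs1 hp hd hm hL).norm
  have h3 := h2.comp_measurePreserving measurePreserving_swap_energyMeasure
  refine ((h1.add h2).add h3).mono (measurable_incr hm).aestronglyMeasurable
    (.of_forall fun z => ?_)
  refine le_trans ?_ (le_abs_self _)
  simp only [Pi.add_apply, Function.comp_apply, Prod.fst_swap, Prod.snd_swap]
  have hf : d ≤ HeisUniq.hdist z.1 z.2 → farInd d (HeisUniq.hdist z.1 z.2) = 1 := fun h =>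
    Set.indicator_of_mem h _
  have n1 : 0 ≤ (ω ×ˢ ω).indicator (fun z => ‖incr r z‖ + ‖incr v z‖) z :=
    Set.indicator_nonneg (fun _ _ => by positivity) z
  by_cases hz1 : z.1 ∈ ω
  · by_cases hz2 : z.2 ∈ ω
    · have hz : z ∈ ω ×ˢ ω := ⟨hz1, hz2⟩
      rw [Set.indicator_of_mem hz]
      have hb := (trunc_between (r z.1 - v z.1) (r z.2 - v z.2)).abs_le
      have h4 : ‖incr φ z‖ ≤ ‖incr r z‖ + ‖incr v z‖ := by
        refine hb.trans ?_
        have : r z.1 - v z.1 - (r z.2 - v z.2) = incr r z - incr v z := by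
          simp only [incr]; ring
        rw [this]
        exact abs_sub _ _
      have n2 := norm_nonneg (φ z.1 * (farInd d (HeisUniq.hdist z.1 z.2)).toReal)
      have n3 := norm_nonneg (φ z.2 * (farInd d (HeisUniq.hdist z.2 z.1)).toReal)
      linarith
    · have e2 : φ z.2 = 0 := hφK _ fun h => hz2 (hKω h)
      by_cases hzK : z.1 ∈ K
      · rw [hf (hdist _ hzK _ hz2)]
        rw [show incr φ z = φ z.1 by simp [incr, e2]]
        simpa [e2] using n1
      · have e1 := hφK _ hzK
        rw [show incr φ z = 0 by simp [incr, e1, e2]]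
        simpa [e1, e2] using n1
  · have e1 : φ z.1 = 0 := hφK _ fun h => hz1 (hKω h)
    by_cases hzK : z.2 ∈ K
    · rw [hdist_comm z.2 z.1, hf (by rw [hdist_comm]; exact hdist _ hzK _ hz1)]
      rw [show incr φ z = -φ z.2 by simp [incr, e1]]
      simpa [e1] using n1
    · have e2 := hφK _ hzK
      rw [show incr φ z = 0 by simp [incr, e1, e2]]
      simpa [e1, e2] using n1

/-! ### Continuity of left translations in the energy norm -/

theorem tendsto_eLpNorm_comp_sub {Y : Type*} [TopologicalSpace Y] [MeasurableSpace Y]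
    [BorelSpace Y] [R1Space Y] {μ : Measure Y} [μ.InnerRegularCompactLTTop]
    [IsLocallyFiniteMeasure μ] {q : ENNReal} (hq1 : 1 ≤ q) (hq : q ≠ ⊤)
    {T : Heis N → Y → Y} (hT : Continuous fun w : Heis N × Y => T w.1 w.2)
    (hmp : ∀ a, MeasurePreserving (T a) μ μ) (hT0 : ∀ y, T 0 y = y)
    {F : Y → ℝ} (hF : MemLp F q μ) :
    Tendsto (fun a => eLpNorm (fun y => F (T a y) - F y) q μ) (𝓝 0) (𝓝 0) := by
  have : Fact (1 ≤ q) := ⟨hq1⟩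
  let Tc : C(Heis N, C(Y, Y)) := ContinuousMap.curry ⟨fun w : Heis N × Y => T w.1 w.2, hT⟩
  have hmp' : ∀ a, MeasurePreserving (Tc a) μ μ := hmp
  have h := Filter.Tendsto.compMeasurePreservingLp (l := 𝓝 (0 : Heis N)) (f := fun _ => hF.toLp F)
    (f₀ := hF.toLp F) (g := fun a => Tc a) (g₀ := Tc 0) tendsto_const_nhds
    (Tc.continuous.tendsto 0) hmp' (hmp' 0) hq
  have h0 : Lp.compMeasurePreserving (Tc 0) (hmp' 0) (hF.toLp F) = hF.toLp F := by
    rw [Lp.toLp_compMeasurePreserving]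
    congr 1
    funext y
    exact congrArg F (hT0 y)
  rw [h0] at h
  have h1 := (Lp.tendsto_Lp_iff_tendsto_eLpNorm' _ _).1 h
  refine h1.congr fun a => eLpNorm_congr_ae ?_
  rw [Lp.toLp_compMeasurePreserving]
  filter_upwards [MemLp.coeFn_toLp hF,
    MemLp.coeFn_toLp (hF.comp_measurePreserving (hmp' a))] with y h2 h3
  rw [Pi.sub_apply, h2]
  exact congrArg (· - F y) h3

theorem eLpNorm_energyMeasure (hp : 1 < p) {G : Heis N × Heis N → ℝ} (hG : Measurable G) :
    eLpNorm G (ENNReal.ofReal p) (energyMeasure N s p)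
      = eLpNorm (fun z => (kernel s p z).toReal ^ (1 / p) * G z) (ENNReal.ofReal p)
        ((volume : Measure (Heis N)).prod volume) := by
  have hp0 : ENNReal.ofReal p ≠ 0 := by simp; linarith
  rw [eLpNorm_eq_lintegral_rpow_enorm_toReal hp0 ENNReal.ofReal_ne_top,
    eLpNorm_eq_lintegral_rpow_enorm_toReal hp0 ENNReal.ofReal_ne_top,
    lintegral_energyMeasure (hG.enorm.pow_const _), ENNReal.toReal_ofReal (by linarith)]
  congr 1
  refine lintegral_congr fun z => ?_
  rw [enorm_mul, ENNReal.mul_rpow_of_nonneg _ _ (by linarith)]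
  congr 1
  have hk : kernel s p z ≠ ⊤ := ENNReal.ofReal_ne_top
  rw [Real.enorm_eq_ofReal_abs, abs_of_nonneg (by positivity),
    ENNReal.ofReal_rpow_of_nonneg (by positivity) (by linarith : 0 ≤ p),
    ← Real.rpow_mul (by positivity), one_div_mul_cancel (by linarith), Real.rpow_one,
    ENNReal.ofReal_toReal hk]

/-- The energy density with the weight absorbed in the function, so that it lives in an `L^p` space
of a locally finite measure. -/
def weightedIncr (s p : ℝ) (g : Heis N → ℝ) (z : Heis N × Heis N) : ℝ :=
  (kernel s p z).toReal ^ (1 / p) * incr g z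

theorem measurable_weightedIncr {g : Heis N → ℝ} (hg : Measurable g) :
    Measurable (weightedIncr s p g) :=
  (measurable_kernel.ennreal_toReal.pow_const _).mul (measurable_incr hg)

theorem FiniteEnergy.weightedIncr_memLp (hp : 1 < p) {g : Heis N → ℝ} (h : FiniteEnergy s p g) :
    MemLp (weightedIncr s p g) (ENNReal.ofReal p) ((volume : Measure (Heis N)).prod volume) := by
  refine ⟨(measurable_weightedIncr h.measurable).aestronglyMeasurable, ?_⟩
  have := h.incr_memLp.2
  rwa [eLpNorm_energyMeasure hp (measurable_incr h.measurable)] at this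

theorem continuous_hmul_prod :
    Continuous fun w : Heis N × (Heis N × Heis N) => (hmul w.1 w.2.1, hmul w.1 w.2.2) :=
  (continuous_hmul.comp (continuous_fst.prodMk (continuous_fst.comp continuous_snd))).prodMk
    (continuous_hmul.comp (continuous_fst.prodMk (continuous_snd.comp continuous_snd)))

theorem FiniteEnergy.tendsto_comp_hmul (hp : 1 < p) {g : Heis N → ℝ} (h : FiniteEnergy s p g) :
    Tendsto (fun a => eLpNorm (fun x => g (hmul a x) - g x) (ENNReal.ofReal p) volume)
      (𝓝 0) (𝓝 0) :=
  tendsto_eLpNorm_comp_sub (by simpa using hp.le) ENNReal.ofReal_ne_top continuous_hmul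
    measurePreserving_hmul zero_hmul h.memLp

theorem FiniteEnergy.tendsto_weightedIncr_hmul (hp : 1 < p) {g : Heis N → ℝ}
    (h : FiniteEnergy s p g) :
    Tendsto (fun a => eLpNorm (fun z => weightedIncr s p g (hmul a z.1, hmul a z.2)
      - weightedIncr s p g z) (ENNReal.ofReal p) ((volume : Measure (Heis N)).prod volume))
      (𝓝 0) (𝓝 0) :=
  have : Measure.Regular ((volume : Measure (Heis N)).prod (volume : Measure (Heis N))) :=
    Measure.Regular.of_sigmaCompactSpace_of_isLocallyFiniteMeasure _
  tendsto_eLpNorm_comp_sub (by simpa using hp.le) ENNReal.ofReal_ne_top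
    (T := fun a z => (hmul a z.1, hmul a z.2)) continuous_hmul_prod
    measurePreserving_hmul_prod (fun z => by simp [zero_hmul]) (h.weightedIncr_memLp hp)

theorem weightedIncr_hmul (g : Heis N → ℝ) (a : Heis N) (z : Heis N × Heis N) :
    weightedIncr s p g (hmul a z.1, hmul a z.2) = weightedIncr s p (fun x => g (hmul a x)) z := by
  simp only [weightedIncr, kernel, incr, hdist_hmul]

theorem weightedIncr_sub (g g' : Heis N → ℝ) (z : Heis N × Heis N) :
    weightedIncr s p g z - weightedIncr s p g' z
      = weightedIncr s p (fun x => g x - g' x) z := by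
  simp only [weightedIncr, incr]; ring

theorem FiniteEnergy.tendsto_incr_hmul (hp : 1 < p) {g : Heis N → ℝ} (h : FiniteEnergy s p g) :
    Tendsto (fun a => eLpNorm (incr fun x => g (hmul a x) - g x) (ENNReal.ofReal p)
      (energyMeasure N s p)) (𝓝 0) (𝓝 0) := by
  refine (h.tendsto_weightedIncr_hmul hp).congr fun a => ?_
  have hm : Measurable fun x => g (hmul a x) - g x :=
    (h.measurable.comp (continuous_hmul_left a).measurable).sub h.measurable
  rw [eLpNorm_energyMeasure hp (measurable_incr hm)]
  simp only [weightedIncr_hmul, weightedIncr_sub]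
  rfl

/-! ### Density of compactly supported functions -/

/-- `g` is a limit, in the norm of `HW^{s,p}(ℍ^N)`, of functions of finite energy vanishing outside
compact subsets of `Ω`. -/
def CompactlyApproximable (s p : ℝ) (Ω : Set (Heis N)) (g : Heis N → ℝ) : Prop :=
  ∀ ε : ENNReal, 0 < ε → ∃ (ψ : Heis N → ℝ) (K : Set (Heis N)), FiniteEnergy s p ψ ∧
    IsCompact K ∧ K ⊆ Ω ∧ (∀ x ∉ K, ψ x = 0) ∧
    eLpNorm (fun x => g x - ψ x) (ENNReal.ofReal p) volume ≤ ε ∧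
    eLpNorm (incr fun x => g x - ψ x) (ENNReal.ofReal p) (energyMeasure N s p) ≤ ε

theorem CompactlyApproximable.add (hp : 1 < p) {Ω : Set (Heis N)} {g g' : Heis N → ℝ}
    (hg : FiniteEnergy s p g) (hg' : FiniteEnergy s p g')
    (h : CompactlyApproximable s p Ω g) (h' : CompactlyApproximable s p Ω g') :
    CompactlyApproximable s p Ω (fun x => g x + g' x) := by
  intro ε hε
  obtain ⟨ψ, K, hψ, hK, hKΩ, hψK, h1, h2⟩ := h (ε / 2) (ENNReal.half_pos hε.ne')
  obtain ⟨ψ', K', hψ', hK', hKΩ', hψK', h1', h2'⟩ := h' (ε / 2) (ENNReal.half_pos hε.ne')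
  have hp1 : 1 ≤ ENNReal.ofReal p := by simpa using hp.le
  refine ⟨fun x => ψ x + ψ' x, K ∪ K', hψ.add hψ', hK.union hK', Set.union_subset hKΩ hKΩ', ?_,
    ?_, ?_⟩
  · intro x hx
    rw [Set.mem_union, not_or] at hx
    simp only [hψK x hx.1, hψK' x hx.2, add_zero]
  · have := eLpNorm_add_le (hg.sub hψ).memLp.1 (hg'.sub hψ').memLp.1 hp1
    refine le_trans (le_of_eq ?_) (this.trans ((add_le_add h1 h1').trans_eq (ENNReal.add_halves ε)))
    congr 1; funext x; simp only [Pi.add_apply]; ring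
  · have := eLpNorm_add_le (hg.sub hψ).incr_memLp.1 (hg'.sub hψ').incr_memLp.1 hp1
    refine le_trans (le_of_eq ?_) (this.trans ((add_le_add h2 h2').trans_eq (ENNReal.add_halves ε)))
    congr 1; funext x; simp only [Pi.add_apply, incr]; ring

theorem hmul_smul (e ξ : Heis N) (τ : ℝ) : hmul (τ • e) ξ = ξ + τ • (hmul e ξ - ξ) := by
  ext <;> simp [hmul, inner_smul_left]
  · ring
  · ring
  · ring

/-- Near each point of its closure, a smooth domain is pushed into itself by small left
translations in a suitable direction. The velocities of left translations at a given point fill the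
whole tangent space, so characteristic boundary points need no separate treatment. -/
theorem IsSmoothBoundedDomain.exists_inward_translation {Ω : Set (Heis N)}
    (hΩ : IsSmoothBoundedDomain Ω) {x₀ : Heis N} (hx₀ : x₀ ∈ closure Ω) :
    ∃ ϱ : ℝ, 0 < ϱ ∧ ∃ e : Heis N, ∀ᶠ τ : ℝ in 𝓝[>] 0,
      ∀ ξ ∈ closure Ω ∩ Metric.closedBall x₀ ϱ, hmul (τ • e) ξ ∈ Ω := by
  by_cases hin : x₀ ∈ Ω
  · obtain ⟨ϱ, hϱ, hball⟩ := Metric.nhds_basis_closedBall.mem_iff.1 (hΩ.isOpen.mem_nhds hin)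
    refine ⟨ϱ, hϱ, 0, .of_forall fun τ ξ hξ => ?_⟩
    rw [smul_zero, zero_hmul]
    exact hball hξ.2
  have hfr : x₀ ∈ frontier Ω := ⟨hx₀, by rwa [hΩ.isOpen.interior_eq]⟩
  obtain ⟨U, hU, hxU, ρ, hρ, hρ0, hΩU⟩ := hΩ.smooth_boundary x₀ hfr
  have hρc : ContinuousOn ρ U := hρ.continuousOn
  have hρle : ∀ ξ ∈ closure Ω, ξ ∈ U → ρ ξ ≤ 0 := by
    intro ξ hξ hξU
    by_contra! hpos
    have h1 : ∀ᶠ η in 𝓝 ξ, 0 < ρ η :=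
      (hρc.continuousAt (hU.mem_nhds hξU)).eventually (lt_mem_nhds hpos)
    obtain ⟨η, hηΩ, hη1, hηU⟩ :=
      ((mem_closure_iff_frequently.1 hξ).and_eventually (h1.and (hU.mem_nhds hξU))).exists
    have : η ∈ Ω ∩ U := ⟨hηΩ, hηU⟩
    rw [hΩU] at this
    exact absurd this.2 (not_lt.2 hη1.le)
  set L := fderiv ℝ ρ x₀ with hL
  have hstrict : HasStrictFDerivAt ρ L x₀ :=
    (hρ.contDiffAt (hU.mem_nhds hxU)).hasStrictFDerivAt (by simp)
  obtain ⟨w, hw⟩ : ∃ w, L w < 0 := by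
    obtain ⟨w, hw⟩ : ∃ w, L w ≠ 0 := by
      by_contra! h
      exact hρ0 (ContinuousLinearMap.ext h)
    rcases lt_or_gt_of_ne hw with h | h
    · exact ⟨w, h⟩
    · exact ⟨-w, by simpa using h⟩
  -- the left translations along `e` have velocity `w` at `x₀`
  set e : Heis N := hmul (x₀ + w) (hinv x₀) with he
  have hew : hmul e x₀ - x₀ = w := by
    have h := hmul_hinv_cancel x₀ x₀
    rw [he, hmul_assoc, hinv_hmul, hmul_zero]; simp
  set c : ℝ := -(L w) / (2 * (‖w‖ + 1)) with hc
  have hc0 : 0 < c := div_pos (by linarith) (by positivity)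
  have hneg : L w + c * ‖w‖ < 0 := by
    have h1 : c * ‖w‖ ≤ -(L w) / 2 := by
      rw [hc, div_mul_eq_mul_div, div_le_div_iff₀ (by positivity) (by norm_num)]
      nlinarith [norm_nonneg w]
    linarith
  have hV : ∀ᶠ ξ in 𝓝 x₀, L (hmul e ξ - ξ) + c * ‖hmul e ξ - ξ‖ < 0 := by
    have hcont : Continuous fun ξ => L (hmul e ξ - ξ) + c * ‖hmul e ξ - ξ‖ := by
      have := continuous_hmul_left e
      fun_prop
    have := hcont.tendsto x₀
    rw [hew] at this
    exact this.eventually (gt_mem_nhds hneg)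
  have hmove : Tendsto (fun w : ℝ × Heis N => (hmul (w.1 • e) w.2, w.2)) (𝓝 (0, x₀))
      (𝓝 (x₀, x₀)) := by
    have hcont : Continuous fun w : ℝ × Heis N => (hmul (w.1 • e) w.2, w.2) :=
      (continuous_hmul.comp ((continuous_fst.smul continuous_const).prodMk
        continuous_snd)).prodMk continuous_snd
    have := hcont.tendsto (0, x₀)
    simpa [zero_hmul] using this
  -- strict differentiability makes the estimate uniform in the starting point `ξ`
  have hstr := hmove.eventually (hstrict.isLittleO.def hc0)
  have hUev := hmove.eventually ((hU.prod hU).mem_nhds (Set.mk_mem_prod hxU hxU))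
  have hVev : ∀ᶠ w : ℝ × Heis N in 𝓝 (0, x₀),
      L (hmul e w.2 - w.2) + c * ‖hmul e w.2 - w.2‖ < 0 :=
    (continuous_snd.tendsto (0, x₀)).eventually hV
  have hall := hstr.and (hUev.and hVev)
  rw [nhds_prod_eq, eventually_prod_iff] at hall
  obtain ⟨pa, hpa, pb, hpb, hab⟩ := hall
  obtain ⟨ϱ, hϱ, hball⟩ := Metric.nhds_basis_closedBall.mem_iff.1 hpb
  refine ⟨ϱ, hϱ, e, ?_⟩
  filter_upwards [nhdsWithin_le_nhds hpa, self_mem_nhdsWithin] with τ hτ hτ0 ξ hξ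
  obtain ⟨h1, ⟨h2, h3⟩, h4⟩ := hab hτ (hball hξ.2)
  have hτ0' : 0 < τ := hτ0
  have : hmul (τ • e) ξ ∈ Ω ∩ U := by
    rw [hΩU]
    refine ⟨h2, ?_⟩
    have h5 := hρle ξ hξ.1 h3
    simp only at h1
    rw [hmul_smul] at h1 ⊢
    rw [add_sub_cancel_left, norm_smul, map_smul, smul_eq_mul, Real.norm_eq_abs, Real.norm_eq_abs,
      abs_of_pos hτ0'] at h1
    have h6 := le_of_abs_le h1
    have h7 := mul_neg_of_pos_of_neg hτ0' h4
    nlinarith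
  exact this.1

theorem compactlyApproximable_of_inward_translation (hp : 1 < p) {Ω : Set (Heis N)}
    {K₀ : Set (Heis N)} (hK₀ : IsCompact K₀) {e : Heis N}
    (he : ∀ᶠ τ : ℝ in 𝓝[>] 0, ∀ ξ ∈ K₀, hmul (τ • e) ξ ∈ Ω) {g : Heis N → ℝ}
    (hg : FiniteEnergy s p g) (hgK : ∀ x ∉ K₀, g x = 0) :
    CompactlyApproximable s p Ω g := by
  intro ε hε
  have hlim : Tendsto (fun τ : ℝ => hinv (τ • e)) (𝓝[>] 0) (𝓝 0) := by
    have : Continuous fun τ : ℝ => hinv (τ • e) :=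
      continuous_hinv.comp (continuous_id.smul continuous_const)
    have := this.tendsto 0
    simp only [zero_smul] at this
    rw [show hinv (0 : Heis N) = 0 from neg_zero] at this
    exact this.mono_left nhdsWithin_le_nhds
  have h1 := ((hg.tendsto_comp_hmul hp).comp hlim).eventually (ge_mem_nhds hε)
  have h2 := ((hg.tendsto_incr_hmul hp).comp hlim).eventually (ge_mem_nhds hε)
  obtain ⟨τ, hτ, h1, h2⟩ := (he.and (h1.and h2)).exists
  refine ⟨fun x => g (hmul (hinv (τ • e)) x), hmul (τ • e) '' K₀, hg.comp_hmul _,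
    hK₀.image (continuous_hmul_left _), ?_, ?_, ?_, ?_⟩
  · rintro _ ⟨ξ, hξ, rfl⟩
    exact hτ ξ hξ
  · intro x hx
    by_contra hne
    refine hx ⟨hmul (hinv (τ • e)) x, ?_, hmul_hinv_cancel _ _⟩
    by_contra hK
    exact hne (hgK _ hK)
  · refine le_trans (le_of_eq ?_) h1
    rw [Function.comp_apply, ← eLpNorm_neg]
    congr 1; funext x; simp
  · refine le_trans (le_of_eq ?_) h2
    rw [Function.comp_apply, ← eLpNorm_neg]
    congr 1; funext x; simp [incr]; ring

/-- A Lipschitz bump, equal to `1` on the ball of radius `ϱ / 2` and to `0` off that of radius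
`ϱ`. -/
def bump (x₀ : Heis N) (ϱ : ℝ) (x : Heis N) : ℝ := max 0 (min 1 (2 - 2 / ϱ * dist x x₀))

theorem lipschitzWith_bump (x₀ : Heis N) {ϱ : ℝ} (hϱ : 0 < ϱ) :
    LipschitzWith (Real.toNNReal (2 / ϱ)) (bump x₀ ϱ) := by
  refine LipschitzWith.of_dist_le_mul fun x y => ?_
  rw [Real.coe_toNNReal _ (by positivity), Real.dist_eq]
  have h1 : |dist x x₀ - dist y x₀| ≤ dist x y := abs_dist_sub_le x y x₀
  have h2 : 0 < 2 / ϱ := by positivity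
  have h3 : |2 / ϱ * dist x x₀ - 2 / ϱ * dist y x₀| ≤ 2 / ϱ * dist x y := by
    rw [← mul_sub, abs_mul, abs_of_pos h2]; gcongr
  refine le_trans ?_ h3
  unfold bump
  grind

theorem abs_bump_le (x₀ : Heis N) (ϱ : ℝ) (x : Heis N) : |bump x₀ ϱ x| ≤ 1 := by
  unfold bump; grind

theorem bump_eq_one {x₀ x : Heis N} {ϱ : ℝ} (hϱ : 0 < ϱ) (h : dist x x₀ ≤ ϱ / 2) :
    bump x₀ ϱ x = 1 := by
  have : 2 / ϱ * dist x x₀ ≤ 1 := by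
    rw [div_mul_eq_mul_div, div_le_one hϱ]; linarith
  unfold bump
  generalize 2 / ϱ * dist x x₀ = y at this
  grind

theorem bump_eq_zero {x₀ x : Heis N} {ϱ : ℝ} (hϱ : 0 < ϱ) (h : ϱ ≤ dist x x₀) :
    bump x₀ ϱ x = 0 := by
  have : 2 ≤ 2 / ϱ * dist x x₀ := by
    rw [div_mul_eq_mul_div, le_div_iff₀ hϱ]; linarith
  unfold bump
  generalize 2 / ϱ * dist x x₀ = y at this
  grind

/-- Functions of finite energy vanishing off the closure of a smooth domain are limits of functions
supported in compact subsets of the domain. -/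
theorem FiniteEnergy.compactlyApproximable (hs0 : 0 < s) (hs1 : s < 1) (hp : 1 < p)
    {Ω : Set (Heis N)} (hΩ : IsSmoothBoundedDomain Ω) {g : Heis N → ℝ} (hg : FiniteEnergy s p g)
    (hgΩ : ∀ x ∉ closure Ω, g x = 0) : CompactlyApproximable s p Ω g := by
  have hcomp : IsCompact (closure Ω) := hΩ.isBounded.isCompact_closure
  have hex : ∀ x ∈ closure Ω, ∃ ϱ : ℝ, 0 < ϱ ∧ ∃ e : Heis N, ∀ᶠ τ : ℝ in 𝓝[>] 0,
      ∀ ξ ∈ closure Ω ∩ Metric.closedBall x ϱ, hmul (τ • e) ξ ∈ Ω := fun x hx =>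
    hΩ.exists_inward_translation hx
  choose! ϱ hϱ e he using hex
  obtain ⟨t, ht, hcover⟩ := hcomp.elim_nhds_subcover (fun x => Metric.closedBall x (ϱ x / 2))
    fun x hx => Metric.closedBall_mem_nhds x (half_pos (hϱ x hx))
  -- the bumps are peeled off one at a time
  have key : ∀ t : Finset (Heis N), (∀ x ∈ t, x ∈ closure Ω) → ∃ h : Heis N → ℝ,
      FiniteEnergy s p h ∧ (∀ x, g x = 0 → h x = 0) ∧
      (∀ a ∈ t, ∀ x ∈ Metric.closedBall a (ϱ a / 2), h x = 0) ∧
      CompactlyApproximable s p Ω (fun x => g x - h x) := by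
    classical
    intro t
    induction t using Finset.induction_on with
    | empty =>
      intro _
      refine ⟨g, hg, fun _ h => h, by simp, fun ε hε => ?_⟩
      refine ⟨fun x => g x - g x, ∅, hg.sub hg, isCompact_empty, Set.empty_subset _,
        fun x _ => sub_self _, ?_, ?_⟩
      · simp
      · have : (incr fun x : Heis N => g x - g x - (g x - g x)) = 0 := by
          funext z; simp [incr]
        rw [this]; simp
    | insert a t _ ih =>
      intro hat
      obtain ⟨h, hfe, hgh, hth, happ⟩ := ih fun x hx => hat x (Finset.mem_insert_of_mem hx)
      have ha : a ∈ closure Ω := hat a (Finset.mem_insert_self a t)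
      have hb : FiniteEnergy s p (fun x => bump a (ϱ a) x * h x) := by
        refine hfe.mul_lipschitz hs0 hs1 hp (lipschitzWith_bump a (hϱ a ha)) (abs_bump_le a _)
          (R := ‖a‖ + ϱ a) fun x hx => bump_eq_zero (hϱ a ha) ?_
        rw [dist_eq_norm]
        linarith [norm_sub_norm_le x a]
      have hbapp : CompactlyApproximable s p Ω (fun x => bump a (ϱ a) x * h x) := by
        refine compactlyApproximable_of_inward_translation hp
          (hcomp.inter_right Metric.isClosed_closedBall) (he a ha) hb fun x hx => ?_
        by_cases hxΩ : x ∈ closure Ω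
        · rw [bump_eq_zero (hϱ a ha), zero_mul]
          by_contra! hlt
          exact hx ⟨hxΩ, Metric.mem_closedBall.2 hlt.le⟩
        · rw [hgh x (hgΩ x hxΩ), mul_zero]
      refine ⟨fun x => h x - bump a (ϱ a) x * h x, hfe.sub hb, fun x hx => by simp [hgh x hx],
        ?_, ?_⟩
      · intro c hc x hx
        rcases Finset.mem_insert.1 hc with rfl | hc
        · simp only [bump_eq_one (hϱ c ha) (Metric.mem_closedBall.1 hx), one_mul, sub_self]
        · simp only [hth c hc x hx, mul_zero, sub_self]
      · have := happ.add hp (hg.sub hfe) hb hbapp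
        refine Eq.mp ?_ this
        congr 1; funext x; ring
  obtain ⟨h, -, hgh, hth, happ⟩ := key t ht
  have h0 : h = fun _ => 0 := by
    funext x
    by_cases hx : x ∈ closure Ω
    · obtain ⟨a, ha, hxa⟩ := Set.mem_iUnion₂.1 (hcover hx)
      exact hth a ha x hxa
    · exact hgh x (hgΩ x hx)
  simpa [h0] using happ

/-! ### Mollification along left translations -/

theorem eLpNorm_le_iff_lintegral {α : Type*} [MeasurableSpace α] {μ : Measure α} (hp : 1 < p)
    {F : α → ℝ} {ε : ENNReal} :
    eLpNorm F (ENNReal.ofReal p) μ ≤ ε ↔ ∫⁻ x, ‖F x‖ₑ ^ p ∂μ ≤ ε ^ p := by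
  rw [eLpNorm_eq_lintegral_rpow_enorm_toReal (by simp; linarith) ENNReal.ofReal_ne_top,
    ENNReal.toReal_ofReal (by linarith), one_div, ENNReal.rpow_inv_le_iff (by linarith)]

/-- Minkowski's inequality for averages over a probability measure. -/
theorem eLpNorm_integral_le {Y : Type*} [MeasurableSpace Y] {μ : Measure Y} [SFinite μ]
    {X : Type*} [MeasurableSpace X] {ν : Measure X} [IsProbabilityMeasure ν] (hp : 1 < p)
    {H : X → Y → ℝ} (hH : Measurable (Function.uncurry H)) {ε : ENNReal}
    (h : ∀ᵐ a ∂ν, eLpNorm (H a) (ENNReal.ofReal p) μ ≤ ε) :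
    eLpNorm (fun y => ∫ a, H a y ∂ν) (ENNReal.ofReal p) μ ≤ ε := by
  rw [eLpNorm_le_iff_lintegral hp]
  have hp1 : 1 ≤ ENNReal.ofReal p := by simpa using hp.le
  have hHy : ∀ y, Measurable fun a => H a y := fun y =>
    hH.comp (measurable_id.prodMk measurable_const)
  calc ∫⁻ y, ‖∫ a, H a y ∂ν‖ₑ ^ p ∂μ
      ≤ ∫⁻ y, ∫⁻ a, ‖H a y‖ₑ ^ p ∂ν ∂μ := by
        refine lintegral_mono fun y => ?_
        have h1 : ‖∫ a, H a y ∂ν‖ₑ ≤ eLpNorm (fun a => H a y) (ENNReal.ofReal p) ν := by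
          refine (enorm_integral_le_lintegral_enorm _).trans ?_
          rw [← eLpNorm_one_eq_lintegral_enorm]
          exact eLpNorm_le_eLpNorm_of_exponent_le hp1 (hHy y).aestronglyMeasurable
        refine (ENNReal.rpow_le_rpow h1 (by linarith)).trans (le_of_eq ?_)
        rw [eLpNorm_eq_lintegral_rpow_enorm_toReal (by simp; linarith) ENNReal.ofReal_ne_top,
          ENNReal.toReal_ofReal (by linarith), ← ENNReal.rpow_mul,
          one_div_mul_cancel (by linarith), ENNReal.rpow_one]
    _ = ∫⁻ a, ∫⁻ y, ‖H a y‖ₑ ^ p ∂μ ∂ν := by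
        refine lintegral_lintegral_swap (Measurable.aemeasurable ?_)
        exact (hH.comp measurable_swap).enorm.pow_const p
    _ ≤ ∫⁻ _, ε ^ p ∂ν := by
        refine lintegral_mono_ae ?_
        filter_upwards [h] with a ha
        exact (eLpNorm_le_iff_lintegral hp).1 ha
    _ = ε ^ p := by simp

/-- The average of the left translates of `φ` with respect to `ν`. -/
def mollify (ν : Measure (Heis N)) (φ : Heis N → ℝ) (x : Heis N) : ℝ :=
  ∫ a, φ (hmul (hinv a) x) ∂ν

theorem measurable_hinv_hmul :
    Measurable fun w : Heis N × Heis N => hmul (hinv w.1) w.2 :=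
  (continuous_hmul.comp ((continuous_hinv.comp continuous_fst).prodMk continuous_snd)).measurable

theorem integrable_translates {ν : Measure (Heis N)} [IsProbabilityMeasure ν] {φ : Heis N → ℝ}
    (hφ : Measurable φ) (hφ1 : ∀ x, |φ x| ≤ 1) (x : Heis N) :
    Integrable (fun a => φ (hmul (hinv a) x)) ν :=
  Integrable.of_bound (hφ.comp (measurable_hinv_hmul.comp
    (measurable_id.prodMk measurable_const))).aestronglyMeasurable 1 (.of_forall fun _ => hφ1 _)

theorem eLpNorm_mollify_sub_le {ν : Measure (Heis N)} [IsProbabilityMeasure ν] (hp : 1 < p)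
    {φ : Heis N → ℝ} (hφ : Measurable φ) (hφ1 : ∀ x, |φ x| ≤ 1) {ε : ENNReal}
    (h : ∀ᵐ a ∂ν, eLpNorm (fun x => φ (hmul (hinv a) x) - φ x) (ENNReal.ofReal p) volume ≤ ε) :
    eLpNorm (fun x => mollify ν φ x - φ x) (ENNReal.ofReal p) volume ≤ ε := by
  have heq : (fun x => mollify ν φ x - φ x)
      = fun x => ∫ a, (φ (hmul (hinv a) x) - φ x) ∂ν := by
    funext x
    rw [integral_sub (integrable_translates hφ hφ1 x) (integrable_const _)]
    simp [mollify]
  rw [heq]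
  exact eLpNorm_integral_le hp
    ((hφ.comp measurable_hinv_hmul).sub (hφ.comp measurable_snd)) h

theorem eLpNorm_incr_mollify_sub_le {ν : Measure (Heis N)} [IsProbabilityMeasure ν] (hp : 1 < p)
    {φ : Heis N → ℝ} (hφ : Measurable φ) (hφ1 : ∀ x, |φ x| ≤ 1)
    (hm : Measurable (mollify ν φ)) {ε : ENNReal}
    (h : ∀ᵐ a ∂ν, eLpNorm (incr fun x => φ (hmul (hinv a) x) - φ x) (ENNReal.ofReal p)
      (energyMeasure N s p) ≤ ε) :
    eLpNorm (incr fun x => mollify ν φ x - φ x) (ENNReal.ofReal p) (energyMeasure N s p) ≤ ε := by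
  have hmd : Measurable fun x => mollify ν φ x - φ x := hm.sub hφ
  rw [eLpNorm_energyMeasure hp (measurable_incr hmd)]
  have heq : (fun z => (kernel s p z).toReal ^ (1 / p) * incr (fun x => mollify ν φ x - φ x) z)
      = fun z => ∫ a, (kernel s p z).toReal ^ (1 / p)
          * incr (fun x => φ (hmul (hinv a) x) - φ x) z ∂ν := by
    funext z
    rw [integral_const_mul]
    congr 1
    have i1 := integrable_translates (ν := ν) hφ hφ1 z.1
    have i2 := integrable_translates (ν := ν) hφ hφ1 z.2
    have j1 : Integrable (fun a => φ (hmul (hinv a) z.1) - φ z.1) ν := i1.sub (integrable_const _)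
    have j2 : Integrable (fun a => φ (hmul (hinv a) z.2) - φ z.2) ν := i2.sub (integrable_const _)
    simp only [incr]
    rw [integral_sub j1 j2,
      integral_sub i1 (integrable_const _), integral_sub i2 (integrable_const _)]
    simp [mollify]
  rw [heq]
  have : SFinite ((volume : Measure (Heis N)).prod (volume : Measure (Heis N))) :=
    Measure.prod.instSFinite
  refine eLpNorm_integral_le hp ?_ ?_
  · have m1 : Measurable fun w : Heis N × (Heis N × Heis N) => φ (hmul (hinv w.1) w.2.1) :=
      hφ.comp (measurable_hinv_hmul.comp (measurable_fst.prodMk measurable_snd.fst))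
    have m2 : Measurable fun w : Heis N × (Heis N × Heis N) => φ (hmul (hinv w.1) w.2.2) :=
      hφ.comp (measurable_hinv_hmul.comp (measurable_fst.prodMk measurable_snd.snd))
    exact ((measurable_kernel.ennreal_toReal.pow_const _).comp measurable_snd).mul
      ((m1.sub (hφ.comp measurable_snd.fst)).sub (m2.sub (hφ.comp measurable_snd.snd)))
  · filter_upwards [h] with a ha
    rwa [eLpNorm_energyMeasure hp] at ha
    exact measurable_incr ((hφ.comp (continuous_hmul_left _).measurable).sub hφ)

/-- After the change of variables `a = x ∘ y⁻¹` the mollification is an integral in which only the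
smooth factor depends on `x`. -/
theorem mollify_eq {ρ : Heis N → ℝ} (hρ : Continuous ρ) (hρ0 : ∀ x, 0 ≤ ρ x) {φ : Heis N → ℝ}
    (hφ : Measurable φ) (x : Heis N) :
    mollify (volume.withDensity fun a => ENNReal.ofReal (ρ a)) φ x
      = ∫ y, φ y * ρ (hmul x (hinv y)) := by
  rw [mollify, integral_withDensity_eq_integral_toReal_smul hρ.measurable.ennreal_ofReal
    (.of_forall fun _ => ENNReal.ofReal_lt_top)]
  have hmp := measurePreserving_hmul_hinv x
  have hm : Measurable fun a => (ENNReal.ofReal (ρ a)).toReal • φ (hmul (hinv a) x) :=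
    hρ.measurable.ennreal_ofReal.ennreal_toReal.smul
      (hφ.comp (measurable_hinv_hmul.comp (measurable_id.prodMk measurable_const)))
  have h := integral_map (μ := (volume : Measure (Heis N))) hmp.measurable.aemeasurable
    (f := fun a => (ENNReal.ofReal (ρ a)).toReal • φ (hmul (hinv a) x))
    hm.aestronglyMeasurable
  rw [hmp.map_eq] at h
  rw [h]
  congr 1
  funext y
  rw [ENNReal.toReal_ofReal (hρ0 _), hinv_hmul_rev, hinv_hinv, hmul_assoc, hinv_hmul, hmul_zero,
    smul_eq_mul, mul_comm]

theorem contDiff_mollify {ρ : Heis N → ℝ} (hρ : ContDiff ℝ 1 ρ) (hρ0 : ∀ x, 0 ≤ ρ x)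
    (hρs : ∀ x, 1 < ‖x‖ → ρ x = 0) {φ : Heis N → ℝ} (hφ : Measurable φ)
    (hφi : LocallyIntegrable φ volume) :
    ContDiff ℝ 1 (mollify (volume.withDensity fun a => ENNReal.ofReal (ρ a)) φ) := by
  refine contDiff_iff_contDiffAt.2 fun x₀ => ?_
  set k : Set (Heis N) := (fun w : Heis N × Heis N => hmul (hinv w.1) w.2) ''
    (Metric.closedBall x₀ 1 ×ˢ Metric.closedBall 0 1)
  have hk : IsCompact k := ((isCompact_closedBall x₀ 1).prod (isCompact_closedBall 0 1)).image
    (continuous_hmul.comp ((continuous_hinv.comp continuous_fst).prodMk continuous_snd))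
  have h := contDiffOn_convolution_right_with_param (μ := (volume : Measure (Heis N))) (n := 1)
    (ContinuousLinearMap.mul ℝ ℝ) (g := fun x t => ρ (hmul x t)) (s := Metric.ball x₀ 1)
    Metric.isOpen_ball hk (f := φ) (fun x t hx ht => by
      apply hρs
      by_contra! hle
      exact ht ⟨(x, hmul x t), ⟨Metric.ball_subset_closedBall hx, by simpa using hle⟩,
        hinv_hmul_cancel x t⟩) hφi
    (hρ.comp contDiff_hmul).contDiffOn
  have h0 : ContDiffOn ℝ 1 (fun x : Heis N => (x, (0 : Heis N))) (Metric.ball x₀ 1) :=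
    (contDiff_id.prodMk contDiff_const).contDiffOn
  have h2 := h.comp h0 (fun x hx => ⟨hx, Set.mem_univ _⟩)
  refine ContDiffOn.contDiffAt ?_ (Metric.ball_mem_nhds x₀ one_pos)
  refine h2.congr fun x _ => ?_
  rw [mollify_eq hρ.continuous hρ0 hφ]
  simp only [Function.comp_apply, convolution, ContinuousLinearMap.mul_apply', zero_sub, hinv]

/-- Bounded functions of finite energy supported in a compact subset of `Ω` are limits of `C¹`
functions supported in a fixed, possibly larger, compact subset of `Ω`. -/
theorem FiniteEnergy.exists_contDiff_approx (hp : 1 < p) {Ω K : Set (Heis N)} (hΩ : IsOpen Ω)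
    (hK : IsCompact K) (hKΩ : K ⊆ Ω) {φ : Heis N → ℝ} (hφ : FiniteEnergy s p φ)
    (hφ1 : ∀ x, |φ x| ≤ 1) (hφK : ∀ x ∉ K, φ x = 0) :
    ∃ K' : Set (Heis N), IsCompact K' ∧ K' ⊆ Ω ∧ K ⊆ K' ∧ ∀ ε : ENNReal, 0 < ε →
      ∃ ψ : Heis N → ℝ, ContDiff ℝ 1 ψ ∧ (∀ x, |ψ x| ≤ 1) ∧ (∀ x ∉ K', ψ x = 0) ∧
        eLpNorm (fun x => ψ x - φ x) (ENNReal.ofReal p) volume ≤ ε ∧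
        eLpNorm (incr fun x => ψ x - φ x) (ENNReal.ofReal p) (energyMeasure N s p) ≤ ε := by
  obtain ⟨U, V, hU, -, h0U, hKV, hUV⟩ := generalized_tube_lemma (isCompact_singleton (x := 0)) hK
    (hΩ.preimage (continuous_hmul (N := N))) (by
      rintro ⟨a, x⟩ ⟨ha, hx⟩
      rw [Set.mem_singleton_iff] at ha
      simp only at ha hx
      rw [Set.mem_preimage, ha, zero_hmul]
      exact hKΩ hx)
  obtain ⟨ε₀, hε₀, hball⟩ := Metric.nhds_basis_closedBall.mem_iff.1
    (hU.mem_nhds (Set.singleton_subset_iff.1 h0U))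
  set K' : Set (Heis N) := (fun w : Heis N × Heis N => hmul w.1 w.2) ''
    (Metric.closedBall 0 ε₀ ×ˢ K) with hK'
  refine ⟨K', ((isCompact_closedBall 0 ε₀).prod hK).image continuous_hmul, ?_, ?_,
    fun ε hε => ?_⟩
  · rintro _ ⟨⟨a, x⟩, ⟨ha, hx⟩, rfl⟩
    exact hUV ⟨hball ha, hKV hx⟩
  · intro x hx
    exact ⟨(0, x), ⟨by simp [hε₀.le], hx⟩, zero_hmul x⟩
  have hlim : Tendsto (hinv : Heis N → Heis N) (𝓝 0) (𝓝 0) := by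
    have := (continuous_hinv (N := N)).tendsto 0
    rwa [show hinv (0 : Heis N) = 0 from neg_zero] at this
  have e1 := ((hφ.tendsto_comp_hmul hp).comp hlim).eventually (ge_mem_nhds hε)
  have e2 := ((hφ.tendsto_incr_hmul hp).comp hlim).eventually (ge_mem_nhds hε)
  obtain ⟨r, hr, hrb⟩ := Metric.nhds_basis_ball.mem_iff.1 (e1.and e2)
  set R := min r (min ε₀ 1) with hR
  have hR0 : 0 < R := by positivity
  let b : ContDiffBump (0 : Heis N) := ⟨R / 2, R, by positivity, by linarith⟩
  set ρ := b.normed (volume : Measure (Heis N)) with hρ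
  have hρs : ∀ x, x ∉ Metric.ball (0 : Heis N) R → ρ x = 0 := fun x hx => by
    rw [← Function.notMem_support, b.support_normed_eq]; exact hx
  have hρd : ContDiff ℝ 1 ρ := b.contDiff_normed (n := 1)
  have hρ0 : ∀ x, 0 ≤ ρ x := b.nonneg_normed
  set ν : Measure (Heis N) := volume.withDensity fun a => ENNReal.ofReal (ρ a) with hν
  have hνp : IsProbabilityMeasure ν := by
    refine ⟨?_⟩
    rw [hν, withDensity_apply _ MeasurableSet.univ, Measure.restrict_univ,
      ← ofReal_integral_eq_lintegral_ofReal b.integrable_normed (.of_forall hρ0),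
      b.integral_normed, ENNReal.ofReal_one]
  have hνb : ∀ᵐ a ∂ν, a ∈ Metric.ball (0 : Heis N) R := by
    rw [hν, ae_withDensity_iff hρd.continuous.measurable.ennreal_ofReal]
    refine .of_forall fun a ha => ?_
    by_contra hb
    exact ha (by rw [hρs a hb, ENNReal.ofReal_zero])
  have hloc : LocallyIntegrable φ volume :=
    hφ.memLp.locallyIntegrable (by simpa using hp.le)
  have hd : ContDiff ℝ 1 (mollify ν φ) := contDiff_mollify hρd hρ0 (fun x hx => hρs x (by
    rw [mem_ball_zero_iff, not_lt]
    exact ((min_le_right _ _).trans (min_le_right _ _)).trans hx.le)) hφ.measurable hloc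
  have hνr : ∀ᵐ a ∂ν, a ∈ Metric.ball (0 : Heis N) r := by
    filter_upwards [hνb] with a ha
    exact Metric.ball_subset_ball (min_le_left _ _) ha
  refine ⟨mollify ν φ, hd, fun x => ?_, fun x hx => ?_, ?_, ?_⟩
  · have := norm_integral_le_of_norm_le_const (μ := ν) (C := 1)
      (f := fun a => φ (hmul (hinv a) x)) (.of_forall fun a => hφ1 _)
    simpa [mollify] using this
  · refine integral_eq_zero_of_ae ?_
    filter_upwards [hνb] with a ha
    refine hφK _ fun hxK => hx ⟨(a, hmul (hinv a) x), ⟨?_, hxK⟩, hmul_hinv_cancel a x⟩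
    exact Metric.ball_subset_closedBall
      (Metric.ball_subset_ball ((min_le_right _ _).trans (min_le_left _ _)) ha)
  · refine eLpNorm_mollify_sub_le hp hφ.measurable hφ1 ?_
    filter_upwards [hνr] with a ha
    exact (hrb ha).1
  · refine eLpNorm_incr_mollify_sub_le hp hφ.measurable hφ1 hd.continuous.measurable ?_
    filter_upwards [hνr] with a ha
    exact (hrb ha).2

/-! ### Representatives of weak solutions -/

theorem MemHW.congr {ω : Set (Heis N)} {u u' : Heis N → ℝ} (h : u =ᵐ[volume] u')
    (hu : MemHW s p ω u) : MemHW s p ω u' := by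
  have hω : u =ᵐ[volume.restrict ω] u' := ae_restrict_of_ae h
  refine ⟨hu.1.ae_eq hω, hu.2.ae_eq ?_⟩
  filter_upwards [Measure.quasiMeasurePreserving_fst.ae hω,
    Measure.quasiMeasurePreserving_snd.ae hω] with z h1 h2
  rw [h1, h2]

theorem IsWeakSolution.congr {Ω : Set (Heis N)} {f δ u u' : Heis N → ℝ} (h : u =ᵐ[volume] u')
    (hu : IsWeakSolution s p Ω f δ u) : IsWeakSolution s p Ω f δ u' where
  memHWloc ω hω := (hu.memHWloc ω hω).congr h
  memLp := hu.memLp.ae_eq (ae_restrict_of_ae h)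
  zeroOutside := by
    filter_upwards [h, hu.zeroOutside] with x h1 h2 hx
    rw [← h1, h2 hx]
  zeroOnBoundary := by
    refine ⟨?_, fun θ hθ => ⟨(hu.zeroOnBoundary.2 θ hθ).1.congr ?_, ?_⟩⟩
    · filter_upwards [h, hu.zeroOnBoundary.1] with x h1 h2
      rwa [← h1]
    · filter_upwards [h] with x h1
      rw [h1]
    · filter_upwards [h, (hu.zeroOnBoundary.2 θ hθ).2] with x h1 h2 hx
      rw [← h1, h2 hx]
  locally_bounded_below ω hω := by
    obtain ⟨C, hC, hCu⟩ := hu.locally_bounded_below ω hω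
    refine ⟨C, hC, ?_⟩
    filter_upwards [hCu, ae_restrict_of_ae h] with x h1 h2
    rwa [← h2]
  weak_eq φ h1 h2 h3 := by
    have e1 := hu.weak_eq φ h1 h2 h3
    have e2 : ∫ x in Ω, f x * u x ^ (-δ x) * φ x = ∫ x in Ω, f x * u' x ^ (-δ x) * φ x := by
      refine integral_congr_ae ?_
      filter_upwards [ae_restrict_of_ae h] with x hx
      rw [hx]
    rw [← e2, ← e1]
    refine integral_congr_ae ?_
    filter_upwards [Measure.quasiMeasurePreserving_fst.ae h,
      Measure.quasiMeasurePreserving_snd.ae h] with z hz1 hz2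
    rw [hz1, hz2]

/-- A weak solution that is measurable, nonnegative, and zero off `Ω` at every point. -/
structure IsRegularSolution (s p : ℝ) (Ω : Set (Heis N)) (f : Heis N → ℝ) (δ : ℝ)
    (u : Heis N → ℝ) : Prop where
  isWeakSolution : IsWeakSolution s p Ω f (fun _ => δ) u
  measurable : Measurable u
  nonneg : ∀ x, 0 ≤ u x
  eq_zero : ∀ x ∉ Ω, u x = 0

theorem IsWeakSolution.exists_isRegularSolution {Ω : Set (Heis N)} (hΩ : IsOpen Ω)
    {f u : Heis N → ℝ} {δ : ℝ} (hu : IsWeakSolution s p Ω f (fun _ => δ) u) :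
    ∃ u', u =ᵐ[volume] u' ∧ IsRegularSolution s p Ω f δ u' := by
  set w := hu.memLp.1.mk u with hw
  have hwm : Measurable w := hu.memLp.1.stronglyMeasurable_mk.measurable
  have hwu : ∀ᵐ x ∂volume, x ∈ Ω → u x = w x :=
    (ae_restrict_iff' hΩ.measurableSet).1 hu.memLp.1.ae_eq_mk
  have heq : u =ᵐ[volume] Ω.indicator fun x => max (w x) 0 := by
    filter_upwards [hwu, hu.zeroOutside, hu.zeroOnBoundary.1] with x h1 h2 h3
    by_cases hx : x ∈ Ω
    · rw [Set.indicator_of_mem hx, ← h1 hx, max_eq_left h3]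
    · rw [Set.indicator_of_notMem hx, h2 hx]
  exact ⟨_, heq, hu.congr heq, (hwm.max measurable_const).indicator hΩ.measurableSet,
    fun x => Set.indicator_nonneg (fun _ _ => le_max_right _ _) x,
    fun x hx => Set.indicator_of_notMem hx _⟩

/-! ### Extension of the class of test functions -/

theorem enorm_rpow_abs {q : ℝ} (hq : 0 ≤ q) (t : ℝ) : ‖|t| ^ q‖ₑ = ‖t‖ₑ ^ q := by
  rw [Real.enorm_eq_ofReal_abs, abs_of_nonneg (by positivity), Real.enorm_eq_ofReal_abs,
    ENNReal.ofReal_rpow_of_nonneg (abs_nonneg _) hq]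

theorem enorm_Jp (hp : 1 < p) (t : ℝ) : ‖Jp p t‖ₑ = ‖t‖ₑ ^ (p - 1) := by
  rw [Real.enorm_eq_ofReal_abs, abs_Jp hp, Real.enorm_eq_ofReal_abs,
    ENNReal.ofReal_rpow_of_nonneg (abs_nonneg _) (by linarith)]

/-- Hölder's inequality in the form used for the pairing `J_p(F) G`. -/
theorem lintegral_rpow_mul_le {Y : Type*} [MeasurableSpace Y] (μ : Measure Y) (hp : 1 < p)
    {F G : Y → ℝ} (hF : Measurable F) (hG : Measurable G) :
    ∫⁻ y, ‖F y‖ₑ ^ (p - 1) * ‖G y‖ₑ ∂μ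
      ≤ eLpNorm F (ENNReal.ofReal p) μ ^ (p - 1) * eLpNorm G (ENNReal.ofReal p) μ := by
  have hpq := (Real.HolderConjugate.conjExponent hp).symm
  have h := ENNReal.lintegral_mul_le_Lp_mul_Lq μ hpq
    (f := fun y => ‖F y‖ₑ ^ (p - 1)) (g := fun y => ‖G y‖ₑ)
    (hF.enorm.pow_const _).aemeasurable hG.enorm.aemeasurable
  have hp0 : ENNReal.ofReal p ≠ 0 := by simp; linarith
  have hne : p - 1 ≠ 0 := by linarith
  rw [eLpNorm_eq_lintegral_rpow_enorm_toReal hp0 ENNReal.ofReal_ne_top,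
    eLpNorm_eq_lintegral_rpow_enorm_toReal hp0 ENNReal.ofReal_ne_top,
    ENNReal.toReal_ofReal (by linarith)]
  refine h.trans (le_of_eq ?_)
  congr 1
  simp only [← ENNReal.rpow_mul]
  have e1 : (p - 1) * p.conjExponent = p := by
    rw [Real.conjExponent]; field_simp
  have e2 : 1 / p.conjExponent = 1 / p * (p - 1) := by
    rw [Real.conjExponent]; field_simp
  rw [e1, e2]

theorem integrable_far_fst (hs0 : 0 < s) (hs1 : s < 1) (hp : 1 < p) {d : ℝ} (hd : 0 < d)
    {w : Heis N → ℝ} (hw : Measurable w) (h : Integrable w volume) :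
    Integrable (fun z : Heis N × Heis N => w z.1 * (farInd d (hdist z.1 z.2)).toReal)
      (energyMeasure N s p) := by
  refine ⟨((hw.comp measurable_fst).mul ((measurable_farInd d).comp
    measurable_hdist).ennreal_toReal).aestronglyMeasurable, ?_⟩
  refine lt_of_eq_of_lt (lintegral_congr fun z => ?_)
    (lintegral_far_fst_lt_top hs0 hs1 hp hd hw.enorm h.2)
  rw [enorm_mul]
  congr 1
  unfold farInd
  by_cases hz : hdist z.1 z.2 ∈ Set.Ici d
  · simp [Set.indicator_of_mem hz]
  · simp [Set.indicator_of_notMem hz]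

/-- A majorant, away from the diagonal, of `J_p(u(x) - u(y)) (φ(x) - φ(y))` with `|φ| ≤ 1`. -/
def farMajorant (p d : ℝ) (u : Heis N → ℝ) (z : Heis N × Heis N) : ℝ :=
  2 ^ (p - 1) * (|u z.1| ^ (p - 1) * (farInd d (hdist z.1 z.2)).toReal
    + |u z.2| ^ (p - 1) * (farInd d (hdist z.1 z.2)).toReal)

theorem IsRegularSolution.integrable_farMajorant (hs0 : 0 < s) (hs1 : s < 1) (hp : 1 < p)
    {Ω : Set (Heis N)} (hΩ : IsOpen Ω) {f u : Heis N → ℝ} {δ : ℝ}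
    (hu : IsRegularSolution s p Ω f δ u) {d : ℝ} (hd : 0 < d) :
    Integrable (farMajorant p d u) (energyMeasure N s p) := by
  have hp1 : 0 < p - 1 := by linarith
  have hm : Measurable fun x => |u x| ^ (p - 1) := hu.measurable.norm.pow_const _
  have hi : Integrable (fun x => |u x| ^ (p - 1)) volume := by
    have h1 := hu.isWeakSolution.memLp.2
    rw [eLpNorm_lt_top_iff_lintegral_rpow_enorm_lt_top (by simpa using hp1)
      ENNReal.ofReal_ne_top, ENNReal.toReal_ofReal hp1.le, ← lintegral_indicator
      hΩ.measurableSet] at h1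
    refine ⟨hm.aestronglyMeasurable, lt_of_eq_of_lt (lintegral_congr fun x => ?_) h1⟩
    rw [enorm_rpow_abs hp1.le]
    by_cases hx : x ∈ Ω
    · rw [Set.indicator_of_mem hx]
    · rw [Set.indicator_of_notMem hx, hu.eq_zero x hx, enorm_zero, ENNReal.zero_rpow_of_pos hp1]
  have i1 := integrable_far_fst hs0 hs1 hp hd hm hi
  have i2 := measurePreserving_swap_energyMeasure.integrable_comp_of_integrable i1
  refine (i1.add ?_).const_mul _
  refine i2.congr (.of_forall fun z => ?_)
  simp only [Function.comp_apply, Prod.fst_swap, Prod.snd_swap, hdist_comm]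

theorem abs_incr_le_far {K ω : Set (Heis N)} {d : ℝ} (hKω : K ⊆ ω)
    (hd : ∀ x ∈ K, ∀ y ∉ ω, d ≤ hdist x y) {φ : Heis N → ℝ} (hφ1 : ∀ x, |φ x| ≤ 1)
    (hφK : ∀ x ∉ K, φ x = 0) {z : Heis N × Heis N} (hz : z ∉ ω ×ˢ ω) :
    |incr φ z| ≤ (farInd d (hdist z.1 z.2)).toReal := by
  have hf : d ≤ hdist z.1 z.2 → (farInd d (hdist z.1 z.2)).toReal = 1 := fun h => by
    unfold farInd; rw [Set.indicator_of_mem (by exact h)]; simp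
  by_cases h1 : z.1 ∈ K
  · have h2 : z.2 ∉ ω := fun h2 => hz ⟨hKω h1, h2⟩
    rw [hf (hd _ h1 _ h2), incr, hφK z.2 fun h => h2 (hKω h), sub_zero]
    exact hφ1 _
  by_cases h2 : z.2 ∈ K
  · have h3 : z.1 ∉ ω := fun h3 => hz ⟨h3, hKω h2⟩
    rw [hf (by rw [hdist_comm]; exact hd _ h2 _ h3), incr, hφK z.1 h1, zero_sub, abs_neg]
    exact hφ1 _
  · rw [incr, hφK _ h1, hφK _ h2, sub_zero, abs_zero]
    exact ENNReal.toReal_nonneg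

theorem abs_Jp_mul_le_farMajorant (hp : 1 < p) {K ω : Set (Heis N)} {d : ℝ} (hKω : K ⊆ ω)
    (hd : ∀ x ∈ K, ∀ y ∉ ω, d ≤ hdist x y) {φ : Heis N → ℝ} (hφ1 : ∀ x, |φ x| ≤ 1)
    (hφK : ∀ x ∉ K, φ x = 0) (u : Heis N → ℝ) {z : Heis N × Heis N} (hz : z ∉ ω ×ˢ ω) :
    ‖Jp p (incr u z) * incr φ z‖ ≤ farMajorant p d u z := by
  have hp1 : 0 ≤ p - 1 := by linarith
  have h1 := abs_incr_le_far hKω hd hφ1 hφK hz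
  have h2 : |Jp p (incr u z)| ≤ 2 ^ (p - 1) * (|u z.1| ^ (p - 1) + |u z.2| ^ (p - 1)) := by
    rw [abs_Jp hp]
    exact (Real.rpow_le_rpow (abs_nonneg _) (abs_sub _ _) hp1).trans
      (add_rpow_le_two_rpow hp1 (abs_nonneg _) (abs_nonneg _))
  rw [Real.norm_eq_abs, abs_mul, farMajorant, ← add_mul, ← mul_assoc]
  exact mul_le_mul h2 h1 (abs_nonneg _) (by positivity)

theorem measurable_Jp_mul_incr (hp : 1 < p) {u φ : Heis N → ℝ} (hu : Measurable u)
    (hφ : Measurable φ) : Measurable fun z => Jp p (incr u z) * incr φ z :=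
  ((continuous_Jp hp).measurable.comp (measurable_incr hu)).mul (measurable_incr hφ)

theorem IsRegularSolution.memLp_incr (hp : 1 < p) {Ω : Set (Heis N)}
    {f u : Heis N → ℝ} {δ : ℝ} (hu : IsRegularSolution s p Ω f δ u) {ω : Set (Heis N)}
    (hω : CompactlyInside ω Ω) :
    MemLp (incr u) (ENNReal.ofReal p) ((energyMeasure N s p).restrict (ω ×ˢ ω)) :=
  (hu.isWeakSolution.memHWloc ω hω).incr_memLp hp hω.1.measurableSet hu.measurable

theorem IsRegularSolution.integrable_Jp_mul (hs0 : 0 < s) (hs1 : s < 1) (hp : 1 < p)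
    {Ω : Set (Heis N)} (hΩ : IsOpen Ω) {f u : Heis N → ℝ} {δ : ℝ}
    (hu : IsRegularSolution s p Ω f δ u) {K : Set (Heis N)} (hK : IsCompact K) (hKΩ : K ⊆ Ω)
    {φ : Heis N → ℝ} (hφ : FiniteEnergy s p φ) (hφ1 : ∀ x, |φ x| ≤ 1)
    (hφK : ∀ x ∉ K, φ x = 0) :
    Integrable (fun z => Jp p (incr u z) * incr φ z) (energyMeasure N s p) := by
  obtain ⟨ω, hω, hKω, hωΩ, hωc⟩ := exists_open_between_and_isCompact_closure hK hΩ hKΩ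
  obtain ⟨d, hd, hdist⟩ := exists_le_hdist hK hω hKω
  have hA : MeasurableSet (ω ×ˢ ω) := hω.measurableSet.prod hω.measurableSet
  have hm := measurable_Jp_mul_incr hp hu.measurable hφ.measurable
  have hin : IntegrableOn (fun z => Jp p (incr u z) * incr φ z) (ω ×ˢ ω)
      (energyMeasure N s p) := by
    refine ⟨hm.aestronglyMeasurable, ?_⟩
    have h1 := (hu.memLp_incr hp ⟨hω, hωc, hωΩ⟩).2
    have h2 := (hφ.incr_memLp.restrict (ω ×ˢ ω)).2
    refine lt_of_le_of_lt ?_ (ENNReal.mul_lt_top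
      (ENNReal.rpow_lt_top_of_nonneg (y := p - 1) (by linarith) h1.ne) h2)
    refine le_trans (le_of_eq (lintegral_congr fun z => ?_))
      (lintegral_rpow_mul_le _ hp (measurable_incr hu.measurable) (measurable_incr hφ.measurable))
    rw [enorm_mul, enorm_Jp hp]
  have hout : IntegrableOn (fun z => Jp p (incr u z) * incr φ z) (ω ×ˢ ω)ᶜ
      (energyMeasure N s p) := by
    refine Integrable.mono' (hu.integrable_farMajorant hs0 hs1 hp hΩ hd).integrableOn
      hm.aestronglyMeasurable ?_
    filter_upwards [ae_restrict_mem hA.compl] with z hz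
    exact abs_Jp_mul_le_farMajorant hp hKω hdist hφ1 hφK u hz
  have := hin.union hout
  rwa [Set.union_compl_self, integrableOn_univ] at this

theorem IsRegularSolution.ae_le {Ω : Set (Heis N)} (hΩ : IsOpen Ω)
    {f u : Heis N → ℝ} {δ : ℝ} (hu : IsRegularSolution s p Ω f δ u) {K : Set (Heis N)}
    (hK : IsCompact K) (hKΩ : K ⊆ Ω) :
    ∃ C : ℝ, 0 < C ∧ ∀ᵐ x ∂volume, x ∈ K → C ≤ u x := by
  obtain ⟨ω, hω, hKω, hωΩ, hωc⟩ := exists_open_between_and_isCompact_closure hK hΩ hKΩ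
  obtain ⟨C, hC, h⟩ := hu.isWeakSolution.locally_bounded_below ω ⟨hω, hωc, hωΩ⟩
  refine ⟨C, hC, ?_⟩
  filter_upwards [(ae_restrict_iff' hω.measurableSet).1 h] with x hx hxK
  exact hx (hKω hxK)

/-- On compact subsets of `Ω` the singular factor is bounded, so the right-hand sides are dominated
by a multiple of `|f|`. -/
theorem IsRegularSolution.exists_norm_le {δ : ℝ} (hδ : 0 < δ) {Ω : Set (Heis N)} (hΩ : IsOpen Ω)
    {f u : Heis N → ℝ} (hu : IsRegularSolution s p Ω f δ u) {K : Set (Heis N)}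
    (hK : IsCompact K) (hKΩ : K ⊆ Ω) :
    ∃ C : ℝ, ∀ φ : Heis N → ℝ, (∀ x, |φ x| ≤ 1) → (∀ x ∉ K, φ x = 0) →
      ∀ᵐ x ∂(volume.restrict Ω), ‖f x * u x ^ (-δ) * φ x‖ ≤ C * ‖f x‖ := by
  obtain ⟨c, hc, h⟩ := hu.ae_le hΩ hK hKΩ
  refine ⟨c ^ (-δ), fun φ hφ1 hφK => ?_⟩
  filter_upwards [ae_restrict_of_ae h] with x hx
  by_cases hxK : x ∈ K
  · have h1 : u x ^ (-δ) ≤ c ^ (-δ) :=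
      Real.rpow_le_rpow_of_nonpos hc (hx hxK) (by linarith)
    have h0 : 0 ≤ u x ^ (-δ) := Real.rpow_nonneg (hu.nonneg x) _
    rw [norm_mul, norm_mul, Real.norm_of_nonneg h0]
    have h2 : ‖φ x‖ ≤ 1 := hφ1 x
    calc ‖f x‖ * u x ^ (-δ) * ‖φ x‖ ≤ ‖f x‖ * c ^ (-δ) * 1 := by gcongr
      _ = c ^ (-δ) * ‖f x‖ := by ring
  · rw [hφK x hxK, mul_zero, norm_zero]
    positivity

theorem IsRegularSolution.aestronglyMeasurable_rhs {Ω : Set (Heis N)} {f u : Heis N → ℝ} {δ : ℝ}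
    (hf : IntegrableOn f Ω) (hu : IsRegularSolution s p Ω f δ u) {φ : Heis N → ℝ}
    (hφ : Measurable φ) :
    AEStronglyMeasurable (fun x => f x * u x ^ (-δ) * φ x) (volume.restrict Ω) :=
  (hf.1.mul (hu.measurable.pow_const _).aestronglyMeasurable).mul hφ.aestronglyMeasurable

theorem IsRegularSolution.integrableOn_rhs {δ : ℝ} (hδ : 0 < δ) {Ω : Set (Heis N)} (hΩ : IsOpen Ω)
    {f u : Heis N → ℝ} (hf : IntegrableOn f Ω)
    (hu : IsRegularSolution s p Ω f δ u) {K : Set (Heis N)}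
    (hK : IsCompact K) (hKΩ : K ⊆ Ω) {φ : Heis N → ℝ} (hφ : Measurable φ)
    (hφ1 : ∀ x, |φ x| ≤ 1) (hφK : ∀ x ∉ K, φ x = 0) :
    IntegrableOn (fun x => f x * u x ^ (-δ) * φ x) Ω := by
  obtain ⟨C, hC⟩ := hu.exists_norm_le hδ hΩ hK hKΩ
  exact Integrable.mono' (hf.norm.const_mul C) (hu.aestronglyMeasurable_rhs hf hφ) (hC φ hφ1 hφK)

theorem IsRegularSolution.weak_eq_contDiff {Ω : Set (Heis N)} {f u : Heis N → ℝ} {δ : ℝ}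
    (hu : IsRegularSolution s p Ω f δ u) {K : Set (Heis N)} (hK : IsCompact K)
    (hKΩ : K ⊆ Ω) {φ : Heis N → ℝ} (hφ : ContDiff ℝ 1 φ) (hφK : ∀ x ∉ K, φ x = 0) :
    ∫ z, Jp p (incr u z) * incr φ z ∂(energyMeasure N s p)
      = ∫ x in Ω, f x * u x ^ (-δ) * φ x := by
  have hsupp : tsupport φ ⊆ Ω := by
    refine (closure_minimal ?_ hK.isClosed).trans hKΩ
    intro x hx
    by_contra h
    exact hx (hφK x h)
  rw [← hu.isWeakSolution.weak_eq φ hφ (HasCompactSupport.intro hK hφK) hsupp, energyMeasure,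
    integral_withDensity_eq_integral_toReal_smul measurable_kernel
      (.of_forall fun _ => ENNReal.ofReal_lt_top)]
  congr 1
  funext z
  have := hdist_nonneg z.1 z.2
  rw [kernel, ENNReal.toReal_ofReal (by positivity), smul_eq_mul, div_eq_inv_mul]
  rfl

/-- The weak equation may be tested with every bounded function of finite energy that vanishes
outside a compact subset of `Ω`. -/
theorem IsRegularSolution.weak_eq (hs0 : 0 < s) (hs1 : s < 1) (hp : 1 < p) {δ : ℝ} (hδ : 0 < δ)
    {Ω : Set (Heis N)} (hΩ : IsOpen Ω) {f u : Heis N → ℝ} (hf : IntegrableOn f Ω)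
    (hu : IsRegularSolution s p Ω f δ u) {K : Set (Heis N)} (hK : IsCompact K) (hKΩ : K ⊆ Ω)
    {φ : Heis N → ℝ} (hφ : FiniteEnergy s p φ) (hφ1 : ∀ x, |φ x| ≤ 1)
    (hφK : ∀ x ∉ K, φ x = 0) :
    ∫ z, Jp p (incr u z) * incr φ z ∂(energyMeasure N s p)
      = ∫ x in Ω, f x * u x ^ (-δ) * φ x := by
  obtain ⟨K', hK', hK'Ω, hKK', happ⟩ := hφ.exists_contDiff_approx hp hΩ hK hKΩ hφ1 hφK
  obtain ⟨ω, hω, hK'ω, hωΩ, hωc⟩ := exists_open_between_and_isCompact_closure hK' hΩ hK'Ω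
  obtain ⟨d, hd, hdist⟩ := exists_le_hdist hK' hω hK'ω
  have hA : MeasurableSet (ω ×ˢ ω) := hω.measurableSet.prod hω.measurableSet
  have hφK' : ∀ x ∉ K', φ x = 0 := fun x hx => hφK x fun h => hx (hKK' h)
  have hε : ∀ n : ℕ, (0 : ENNReal) < (n + 1 : ENNReal)⁻¹ := fun n =>
    ENNReal.inv_pos.2 (by finiteness)
  have hεlim : Tendsto (fun n : ℕ => (n + 1 : ENNReal)⁻¹) atTop (𝓝 0) := by
    have := ENNReal.tendsto_inv_nat_nhds_zero.comp (tendsto_add_atTop_nat 1)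
    simpa [Function.comp_def] using this
  choose ψ hψd hψ1 hψK hψL hψE using fun n : ℕ => happ _ (hε n)
  have hψm : ∀ n, Measurable (ψ n) := fun n => (hψd n).continuous.measurable
  have hLim : Tendsto (fun n => eLpNorm (ψ n - φ) (ENNReal.ofReal p) volume) atTop (𝓝 0) :=
    tendsto_of_tendsto_of_tendsto_of_le_of_le tendsto_const_nhds hεlim (fun _ => zero_le) hψL
  obtain ⟨ns, hns, hae⟩ := (tendstoInMeasure_of_tendsto_eLpNorm (by simp; linarith)
    (fun n => (hψm n).aestronglyMeasurable) hφ.measurable.aestronglyMeasurable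
    hLim).exists_seq_tendsto_ae
  have hae2 : ∀ᵐ z ∂(energyMeasure N s p),
      Tendsto (fun n => incr (ψ (ns n)) z) atTop (𝓝 (incr φ z)) := by
    refine energyMeasure_ac.ae_le ?_
    filter_upwards [Measure.quasiMeasurePreserving_fst.ae hae,
      Measure.quasiMeasurePreserving_snd.ae hae] with z h1 h2
    exact h1.sub h2
  have hψfe : ∀ n, FiniteEnergy s p (ψ n) := fun n => by
    have hm : Measurable fun x => ψ n x - φ x := (hψm n).sub hφ.measurable
    have : FiniteEnergy s p (fun x => ψ n x - φ x) :=
      ⟨hm, ⟨hm.aestronglyMeasurable, (hψL n).trans_lt (by finiteness)⟩,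
        ⟨(measurable_incr hm).aestronglyMeasurable, (hψE n).trans_lt (by finiteness)⟩⟩
    simpa using this.add hφ
  have hint : ∀ n, Integrable (fun z => Jp p (incr u z) * incr (ψ n) z) (energyMeasure N s p) :=
    fun n => hu.integrable_Jp_mul hs0 hs1 hp hΩ hK' hK'Ω (hψfe n) (hψ1 n) (hψK n)
  have hint0 := hu.integrable_Jp_mul hs0 hs1 hp hΩ hK hKΩ hφ hφ1 hφK
  -- near the diagonal the integrals converge by Hölder's inequality
  have lim1 : Tendsto (fun n => ∫ z in ω ×ˢ ω, Jp p (incr u z) * incr (ψ (ns n)) z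
      ∂(energyMeasure N s p)) atTop
      (𝓝 (∫ z in ω ×ˢ ω, Jp p (incr u z) * incr φ z ∂(energyMeasure N s p))) := by
    refine tendsto_integral_of_L1 _ hint0.aestronglyMeasurable.restrict
      (.of_forall fun n => (hint (ns n)).integrableOn) ?_
    have hC := (hu.memLp_incr hp ⟨hω, hωc, hωΩ⟩).2
    set C := eLpNorm (incr u) (ENNReal.ofReal p) ((energyMeasure N s p).restrict (ω ×ˢ ω))
    have hb : Tendsto (fun n => C ^ (p - 1) * ((ns n : ENNReal) + 1)⁻¹) atTop (𝓝 0) := by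
      have := ENNReal.Tendsto.const_mul (hεlim.comp hns.tendsto_atTop) (a := C ^ (p - 1))
        (Or.inr (ENNReal.rpow_lt_top_of_nonneg (by linarith) hC.ne).ne)
      simpa using this
    refine tendsto_of_tendsto_of_tendsto_of_le_of_le tendsto_const_nhds hb (fun _ => zero_le)
      fun n => ?_
    have hm : Measurable fun x => ψ (ns n) x - φ x := (hψm _).sub hφ.measurable
    calc ∫⁻ z in ω ×ˢ ω, ‖Jp p (incr u z) * incr (ψ (ns n)) z - Jp p (incr u z) * incr φ z‖ₑ
          ∂(energyMeasure N s p)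
        = ∫⁻ z in ω ×ˢ ω, ‖incr u z‖ₑ ^ (p - 1) * ‖incr (fun x => ψ (ns n) x - φ x) z‖ₑ
          ∂(energyMeasure N s p) := by
          refine lintegral_congr fun z => ?_
          rw [← mul_sub, enorm_mul, enorm_Jp hp]
          congr 2
          simp only [incr]; ring
      _ ≤ C ^ (p - 1) * eLpNorm (incr fun x => ψ (ns n) x - φ x) (ENNReal.ofReal p)
          ((energyMeasure N s p).restrict (ω ×ˢ ω)) :=
        lintegral_rpow_mul_le _ hp (measurable_incr hu.measurable) (measurable_incr hm)
      _ ≤ C ^ (p - 1) * ((ns n : ENNReal) + 1)⁻¹ := by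
        gcongr
        exact (eLpNorm_restrict_le _ _ _ _).trans (hψE (ns n))
  -- away from the diagonal they converge by dominated convergence
  have lim2 : Tendsto (fun n => ∫ z in (ω ×ˢ ω)ᶜ, Jp p (incr u z) * incr (ψ (ns n)) z
      ∂(energyMeasure N s p)) atTop
      (𝓝 (∫ z in (ω ×ˢ ω)ᶜ, Jp p (incr u z) * incr φ z ∂(energyMeasure N s p))) := by
    refine tendsto_integral_of_dominated_convergence (farMajorant p d u)
      (fun n => (hint (ns n)).aestronglyMeasurable.restrict)
      (hu.integrable_farMajorant hs0 hs1 hp hΩ hd).integrableOn (fun n => ?_) ?_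
    · filter_upwards [ae_restrict_mem hA.compl] with z hz
      exact abs_Jp_mul_le_farMajorant hp hK'ω hdist (hψ1 _) (hψK _) u hz
    · filter_upwards [ae_restrict_of_ae hae2] with z hz
      exact hz.const_mul _
  have lim3 : Tendsto (fun n => ∫ x in Ω, f x * u x ^ (-δ) * ψ (ns n) x) atTop
      (𝓝 (∫ x in Ω, f x * u x ^ (-δ) * φ x)) := by
    obtain ⟨C, hC⟩ := hu.exists_norm_le hδ hΩ hK' hK'Ω
    refine tendsto_integral_of_dominated_convergence (fun x => C * ‖f x‖)
      (fun n => hu.aestronglyMeasurable_rhs hf (hψm _)) (hf.norm.const_mul C)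
      (fun n => hC _ (hψ1 _) (hψK _)) ?_
    filter_upwards [ae_restrict_of_ae hae] with x hx
    exact hx.const_mul _
  have lim := lim1.add lim2
  rw [integral_add_compl hA hint0] at lim
  refine tendsto_nhds_unique lim (lim3.congr fun n => ?_)
  rw [integral_add_compl hA (hint _)]
  exact (hu.weak_eq_contDiff hK' hK'Ω (hψd _) (hψK _)).symm

/-! ### Comparison -/

theorem CompactlyApproximable.exists_seq (hp : 1 < p) {Ω : Set (Heis N)} {r : Heis N → ℝ}
    (hr : FiniteEnergy s p r) (h : CompactlyApproximable s p Ω r) :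
    ∃ (ψ : ℕ → Heis N → ℝ) (K : ℕ → Set (Heis N)), (∀ n, FiniteEnergy s p (ψ n)) ∧
      (∀ n, IsCompact (K n)) ∧ (∀ n, K n ⊆ Ω) ∧ (∀ n, ∀ x ∉ K n, ψ n x = 0) ∧
      Tendsto (fun n => eLpNorm (incr fun x => r x - ψ n x) (ENNReal.ofReal p)
        (energyMeasure N s p)) atTop (𝓝 0) ∧
      ∀ᵐ x ∂volume, Tendsto (fun n => ψ n x) atTop (𝓝 (r x)) := by
  have hε : ∀ n : ℕ, (0 : ENNReal) < (n + 1 : ENNReal)⁻¹ := fun n =>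
    ENNReal.inv_pos.2 (by finiteness)
  have hεlim : Tendsto (fun n : ℕ => (n + 1 : ENNReal)⁻¹) atTop (𝓝 0) := by
    have := ENNReal.tendsto_inv_nat_nhds_zero.comp (tendsto_add_atTop_nat 1)
    simpa [Function.comp_def] using this
  choose ψ K hψ hK hKΩ hψK hψL hψE using fun n : ℕ => h _ (hε n)
  have hLim : Tendsto (fun n => eLpNorm (ψ n - r) (ENNReal.ofReal p) volume) atTop (𝓝 0) := by
    refine tendsto_of_tendsto_of_tendsto_of_le_of_le tendsto_const_nhds hεlim (fun _ => zero_le)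
      fun n => ?_
    rw [eLpNorm_sub_comm]
    exact hψL n
  have hELim : Tendsto (fun n => eLpNorm (incr fun x => r x - ψ n x) (ENNReal.ofReal p)
      (energyMeasure N s p)) atTop (𝓝 0) :=
    tendsto_of_tendsto_of_tendsto_of_le_of_le tendsto_const_nhds hεlim (fun _ => zero_le) hψE
  obtain ⟨ns, hns, hae⟩ := (tendstoInMeasure_of_tendsto_eLpNorm (by simp; linarith)
    (fun n => (hψ n).measurable.aestronglyMeasurable) hr.measurable.aestronglyMeasurable
    hLim).exists_seq_tendsto_ae
  exact ⟨fun n => ψ (ns n), fun n => K (ns n), fun n => hψ _, fun n => hK _, fun n => hKΩ _,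
    fun n => hψK _, hELim.comp hns.tendsto_atTop, hae⟩

theorem integrable_Jp_mul_of_finiteEnergy (hp : 1 < p) {r φ : Heis N → ℝ}
    (hr : FiniteEnergy s p r) (hφ : FiniteEnergy s p φ) :
    Integrable (fun z => Jp p (incr r z) * incr φ z) (energyMeasure N s p) := by
  refine ⟨(measurable_Jp_mul_incr hp hr.measurable hφ.measurable).aestronglyMeasurable, ?_⟩
  refine lt_of_le_of_lt ?_ (ENNReal.mul_lt_top
    (ENNReal.rpow_lt_top_of_nonneg (y := p - 1) (by linarith) hr.incr_memLp.2.ne) hφ.incr_memLp.2)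
  refine le_trans (le_of_eq (lintegral_congr fun z => ?_))
    (lintegral_rpow_mul_le _ hp (measurable_incr hr.measurable) (measurable_incr hφ.measurable))
  rw [enorm_mul, enorm_Jp hp]

/-- Truncating a subsolution from below decreases its pairing with test functions supported where
the truncation is inactive. -/
theorem Jp_incr_max_mul_le (hp : 1 < p) {u φ : Heis N → ℝ} {θ : ℝ} (hφ0 : ∀ x, 0 ≤ φ x)
    (hφu : ∀ x, φ x ≠ 0 → θ < u x) (z : Heis N × Heis N) :
    Jp p (incr (fun x => max (u x - θ) 0) z) * incr φ z ≤ Jp p (incr u z) * incr φ z := by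
  have hmono := (Jp_strictMono hp).monotone
  have hz : ∀ x, ¬ θ < u x → φ x = 0 := fun x h => by
    by_contra hne
    exact h (hφu x hne)
  by_cases h1 : θ < u z.1 <;> by_cases h2 : θ < u z.2
  · have : incr (fun x => max (u x - θ) 0) z = incr u z := by
      simp only [incr]
      rw [max_eq_left (by linarith), max_eq_left (by linarith)]; ring
    rw [this]
  · have h3 := hz _ h2
    refine mul_le_mul_of_nonneg_right (hmono ?_) ?_
    · simp only [incr]
      rw [max_eq_left (by linarith), max_eq_right (by linarith)]; linarith
    · simp only [incr]; linarith [hφ0 z.1]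
  · have h3 := hz _ h1
    refine mul_le_mul_of_nonpos_right (hmono ?_) ?_
    · simp only [incr]
      rw [max_eq_right (by linarith), max_eq_left (by linarith)]; linarith
    · simp only [incr]; linarith [hφ0 z.2]
  · have : incr φ z = 0 := by simp [incr, hz _ h1, hz _ h2]
    rw [this, mul_zero, mul_zero]

theorem volume_compl_ne_zero {Ω : Set (Heis N)} (h : Bornology.IsBounded Ω) :
    volume Ωᶜ ≠ 0 := by
  obtain ⟨R, hR⟩ := h.subset_closedBall (0 : Heis N)
  have hopen : IsOpen (Metric.closedBall (0 : Heis N) R)ᶜ := Metric.isClosed_closedBall.isOpen_compl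
  have hne : (Metric.closedBall (0 : Heis N) R)ᶜ.Nonempty := by
    refine ⟨(0, 0, |R| + 1), ?_⟩
    rw [Set.mem_compl_iff, mem_closedBall_zero_iff, not_le]
    have h1 : ‖(|R| + 1 : ℝ)‖ ≤ ‖((0, 0, |R| + 1) : Heis N)‖ :=
      (norm_snd_le ((0, |R| + 1) : EuclideanSpace ℝ (Fin N) × ℝ)).trans
        (norm_snd_le ((0, 0, |R| + 1) : Heis N))
    rw [Real.norm_of_nonneg (by positivity)] at h1
    linarith [le_abs_self R]
  exact fun h0 => (hopen.measure_pos volume hne).ne'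
    (measure_mono_null (Set.compl_subset_compl.2 hR) h0)

/-- A function vanishing off a bounded set whose increments vanish almost everywhere is zero. -/
theorem ae_eq_zero_of_incr_eq_zero {Ω : Set (Heis N)} (hΩ : Bornology.IsBounded Ω)
    {φ : Heis N → ℝ} (hφ : ∀ x ∉ Ω, φ x = 0)
    (h : ∀ᵐ z ∂(energyMeasure N s p), incr φ z = 0) : ∀ᵐ x ∂volume, φ x = 0 := by
  rw [energyMeasure, ae_withDensity_iff measurable_kernel] at h
  filter_upwards [Measure.ae_ae_of_ae_prod h] with x hx
  by_cases hxΩ : x ∈ Ω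
  · have hfreq : ∃ᵐ y ∂(volume : Measure (Heis N)), y ∈ Ωᶜ :=
      frequently_ae_mem_iff.2 (volume_compl_ne_zero hΩ)
    obtain ⟨y, hyΩ, hy⟩ := (hfreq.and_eventually hx).exists
    have hne : 0 < hdist x y := lt_of_le_of_ne (hdist_nonneg x y) fun h0 =>
      hyΩ (eq_of_hdist_eq_zero h0.symm ▸ hxΩ)
    have hk : kernel s p (x, y) ≠ 0 := by
      rw [kernel, Ne, ENNReal.ofReal_eq_zero, not_le]
      positivity
    have := hy hk
    simp only [incr, hφ y hyΩ, sub_zero] at this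
    exact this
  · exact hφ x hxΩ

section Comparison

variable {Ω : Set (Heis N)} {f u v : Heis N → ℝ} {δ θ : ℝ}

/-- The pairings of the two solutions with `trunc (ρ - v)`, where `ρ ≤ (u - θ)⁺` has compact
support. On the support of this test function `v < u`, so that the singular right-hand sides are
ordered. -/
theorem IsRegularSolution.pairing_le (hs0 : 0 < s) (hs1 : s < 1) (hp : 1 < p) (hδ : 0 < δ)
    (hΩ : IsOpen Ω) (hf : IntegrableOn f Ω) (hf0 : ∀ᵐ x ∂(volume.restrict Ω), 0 ≤ f x)
    (hu : IsRegularSolution s p Ω f δ u) (hv : IsRegularSolution s p Ω f δ v) (hθ : 0 < θ)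
    (hr : FiniteEnergy s p fun x => max (u x - θ) 0)
    {ρ : Heis N → ℝ} {K : Set (Heis N)} (hK : IsCompact K)
    (hKΩ : K ⊆ Ω) (hρK : ∀ x ∉ K, ρ x = 0) (hρr : ∀ x, ρ x ≤ max (u x - θ) 0)
    (hφ : FiniteEnergy s p fun x => trunc (ρ x - v x)) :
    Integrable (fun z => Jp p (incr v z) * incr (fun x => trunc (ρ x - v x)) z)
      (energyMeasure N s p) ∧
    0 ≤ ∫ z, Jp p (incr v z) * incr (fun x => trunc (ρ x - v x)) z ∂(energyMeasure N s p) ∧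
    ∫ z, Jp p (incr (fun x => max (u x - θ) 0) z) * incr (fun x => trunc (ρ x - v x)) z
        ∂(energyMeasure N s p)
      ≤ ∫ z, Jp p (incr v z) * incr (fun x => trunc (ρ x - v x)) z ∂(energyMeasure N s p) := by
  set φ : Heis N → ℝ := fun x => trunc (ρ x - v x) with hφdef
  have hφ0 : ∀ x, 0 ≤ φ x := fun x => trunc_nonneg _
  have hφ1 : ∀ x, |φ x| ≤ 1 := fun x => by
    rw [abs_of_nonneg (hφ0 x)]; exact trunc_le_one _
  have hφK : ∀ x ∉ K, φ x = 0 := fun x hx =>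
    trunc_of_nonpos (by rw [hρK x hx]; linarith [hv.nonneg x])
  have hφpos : ∀ x, φ x ≠ 0 → θ < u x ∧ v x ≤ u x := fun x hx => by
    have h1 := pos_of_trunc_ne_zero hx
    have h2 := hρr x
    have h3 := hv.nonneg x
    rcases max_cases (u x - θ) 0 with ⟨h4, h5⟩ | ⟨h4, h5⟩
    · rw [h4] at h2
      constructor <;> linarith
    · linarith
  have hiu := hu.integrable_Jp_mul hs0 hs1 hp hΩ hK hKΩ hφ hφ1 hφK
  have hiv := hv.integrable_Jp_mul hs0 hs1 hp hΩ hK hKΩ hφ hφ1 hφK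
  have hir := integrable_Jp_mul_of_finiteEnergy hp hr hφ
  have heu := hu.weak_eq hs0 hs1 hp hδ hΩ hf hK hKΩ hφ hφ1 hφK
  have hev := hv.weak_eq hs0 hs1 hp hδ hΩ hf hK hKΩ hφ hφ1 hφK
  refine ⟨hiv, ?_, ?_⟩
  · rw [hev]
    refine integral_nonneg_of_ae ?_
    filter_upwards [hf0] with x hx
    exact mul_nonneg (mul_nonneg hx (Real.rpow_nonneg (hv.nonneg x) _)) (hφ0 x)
  · calc ∫ z, Jp p (incr (fun x => max (u x - θ) 0) z) * incr φ z ∂(energyMeasure N s p)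
        ≤ ∫ z, Jp p (incr u z) * incr φ z ∂(energyMeasure N s p) :=
          integral_mono hir hiu (Jp_incr_max_mul_le hp hφ0 fun x hx => (hφpos x hx).1)
      _ = ∫ x in Ω, f x * u x ^ (-δ) * φ x := heu
      _ ≤ ∫ x in Ω, f x * v x ^ (-δ) * φ x := by
          refine integral_mono_ae
            (hu.integrableOn_rhs hδ hΩ hf hK hKΩ hφ.measurable hφ1 hφK)
            (hv.integrableOn_rhs hδ hΩ hf hK hKΩ hφ.measurable hφ1 hφK) ?_
          obtain ⟨c, hc, hcv⟩ := hv.ae_le hΩ hK hKΩ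
          filter_upwards [hf0, ae_restrict_of_ae hcv] with x hfx hvx
          by_cases hx : φ x = 0
          · simp [hx]
          · have hxK : x ∈ K := by
              by_contra h
              exact hx (hφK x h)
            refine mul_le_mul_of_nonneg_right (mul_le_mul_of_nonneg_left ?_ hfx) (hφ0 x)
            exact Real.rpow_le_rpow_of_nonpos (hc.trans_le (hvx hxK)) (hφpos x hx).2 (by linarith)
      _ = ∫ z, Jp p (incr v z) * incr φ z ∂(energyMeasure N s p) := hev.symm

theorem lintegral_enorm_rpow_eq (hp : 1 < p) {α : Type*} [MeasurableSpace α] {μ : Measure α}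
    (F : α → ℝ) : ∫⁻ x, ‖F x‖ₑ ^ p ∂μ = eLpNorm F (ENNReal.ofReal p) μ ^ p := by
  rw [eLpNorm_eq_lintegral_rpow_enorm_toReal (by simp; linarith) ENNReal.ofReal_ne_top,
    ENNReal.toReal_ofReal (by linarith), ← ENNReal.rpow_mul, one_div_mul_cancel (by linarith),
    ENNReal.rpow_one]

theorem integrable_rpow_abs (hp : 1 < p) {α : Type*} [MeasurableSpace α] {μ : Measure α}
    {F : α → ℝ} (hF : Measurable F) (h : MemLp F (ENNReal.ofReal p) μ) :
    Integrable (fun x => |F x| ^ p) μ := by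
  refine ⟨(hF.norm.pow_const p).aestronglyMeasurable, ?_⟩
  refine lt_of_eq_of_lt (lintegral_congr fun x => enorm_rpow_abs (by linarith) _)
    ((eLpNorm_lt_top_iff_lintegral hp).1 h.2)

/-- The energy of `trunc (ρ - v)` is controlled by that of `ρ`, although `v` itself may have
infinite energy. -/
theorem eLpNorm_incr_trunc_le (hp : 1 < p) {ρ : Heis N → ℝ} (hρ : FiniteEnergy s p ρ)
    (hφ : FiniteEnergy s p fun x => trunc (ρ x - v x))
    (hi : Integrable (fun z => Jp p (incr v z) * incr (fun x => trunc (ρ x - v x)) z)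
      (energyMeasure N s p))
    (h0 : 0 ≤ ∫ z, Jp p (incr v z) * incr (fun x => trunc (ρ x - v x)) z
      ∂(energyMeasure N s p)) :
    eLpNorm (incr fun x => trunc (ρ x - v x)) (ENNReal.ofReal p) (energyMeasure N s p) ^ p
      ≤ ENNReal.ofReal (3 ^ p + 6 ^ p)
        * eLpNorm (incr ρ) (ENNReal.ofReal p) (energyMeasure N s p) ^ p := by
  set φ : Heis N → ℝ := fun x => trunc (ρ x - v x) with hφdef
  have i1 := integrable_rpow_abs hp (measurable_incr hφ.measurable) hφ.incr_memLp
  have i2 := integrable_rpow_abs hp (measurable_incr hρ.measurable) hρ.incr_memLp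
  have hbet : ∀ z, Between (incr φ z) (incr ρ z - incr v z) := fun z => by
    have := trunc_between (ρ z.1 - v z.1) (ρ z.2 - v z.2)
    have e : incr ρ z - incr v z = ρ z.1 - v z.1 - (ρ z.2 - v z.2) := by simp only [incr]; ring
    rwa [e]
  have hle : ∫ z, (|incr φ z| ^ p + 2 ^ p * (Jp p (incr v z) * incr φ z)) ∂(energyMeasure N s p)
      ≤ ∫ z, (3 ^ p + 6 ^ p) * |incr ρ z| ^ p ∂(energyMeasure N s p) :=
    integral_mono (i1.add (hi.const_mul _)) (i2.const_mul _)
      fun z => rpow_abs_add_Jp_mul_le hp (hbet z)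
  rw [integral_add i1 (hi.const_mul _), integral_const_mul, integral_const_mul] at hle
  have hle2 : ∫ z, |incr φ z| ^ p ∂(energyMeasure N s p)
      ≤ (3 ^ p + 6 ^ p) * ∫ z, |incr ρ z| ^ p ∂(energyMeasure N s p) := by
    have : (0 : ℝ) ≤ 2 ^ p * ∫ z, Jp p (incr v z) * incr φ z ∂(energyMeasure N s p) :=
      mul_nonneg (by positivity) h0
    linarith
  have conv : ∀ g : Heis N → ℝ, Integrable (fun z => |incr g z| ^ p) (energyMeasure N s p) →
      ENNReal.ofReal (∫ z, |incr g z| ^ p ∂(energyMeasure N s p))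
        = eLpNorm (incr g) (ENNReal.ofReal p) (energyMeasure N s p) ^ p := fun g hg => by
    rw [ofReal_integral_eq_lintegral_ofReal hg (.of_forall fun z => by positivity),
      ← lintegral_enorm_rpow_eq hp]
    refine lintegral_congr fun z => ?_
    rw [← enorm_rpow_abs (by linarith), Real.enorm_of_nonneg (by positivity)]
  rw [← conv φ i1, ← conv ρ i2, ← ENNReal.ofReal_mul (by positivity)]
  exact ENNReal.ofReal_le_ofReal hle2

/-- The monotone quantity `(J_p(dρ) - J_p(dv)) dφ` with `φ = trunc (ρ - v)` is small as soon as `ρ`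
is close to `(u - θ)⁺` in energy. -/
theorem IsRegularSolution.lintegral_monotone_le (hs0 : 0 < s) (hs1 : s < 1) (hp : 1 < p)
    (hδ : 0 < δ) (hΩ : IsOpen Ω) (hf : IntegrableOn f Ω)
    (hf0 : ∀ᵐ x ∂(volume.restrict Ω), 0 ≤ f x)
    (hu : IsRegularSolution s p Ω f δ u) (hv : IsRegularSolution s p Ω f δ v) (hθ : 0 < θ)
    (hr : FiniteEnergy s p fun x => max (u x - θ) 0)
    {ρ : Heis N → ℝ} (hρ : FiniteEnergy s p ρ) {K : Set (Heis N)} (hK : IsCompact K)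
    (hKΩ : K ⊆ Ω) (hρK : ∀ x ∉ K, ρ x = 0) (hρr : ∀ x, ρ x ≤ max (u x - θ) 0)
    {η C : ℝ} (hη : 0 ≤ η) (hC : 0 ≤ C)
    (hJ : ∀ a b : ℝ, |Jp p a - Jp p b| ≤ η * |b| ^ (p - 1) + C * |a - b| ^ (p - 1)) :
    ∫⁻ z, ENNReal.ofReal ((Jp p (incr ρ z) - Jp p (incr v z))
        * incr (fun x => trunc (ρ x - v x)) z) ∂(energyMeasure N s p)
      ≤ (ENNReal.ofReal η * eLpNorm (incr fun x => max (u x - θ) 0) (ENNReal.ofReal p)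
            (energyMeasure N s p) ^ (p - 1)
          + ENNReal.ofReal C * eLpNorm (incr fun x => ρ x - max (u x - θ) 0) (ENNReal.ofReal p)
            (energyMeasure N s p) ^ (p - 1))
        * (ENNReal.ofReal (3 ^ p + 6 ^ p)
          * eLpNorm (incr ρ) (ENNReal.ofReal p) (energyMeasure N s p) ^ p) ^ p⁻¹ := by
  set r : Heis N → ℝ := fun x => max (u x - θ) 0 with hrdef
  obtain ⟨ω, hω, hKω, hωΩ, hωc⟩ := exists_open_between_and_isCompact_closure hK hΩ hKΩ
  have hφ := hρ.trunc_sub hs0 hs1 hp hv.measurable hv.nonneg hK hω hKω hρK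
    (hv.memLp_incr hp ⟨hω, hωc, hωΩ⟩)
  obtain ⟨hiv, hv0, hle⟩ := hu.pairing_le hs0 hs1 hp hδ hΩ hf hf0 hv hθ hr hK hKΩ hρK hρr hφ
  have hE := eLpNorm_incr_trunc_le hp hρ hφ hiv hv0
  set φ : Heis N → ℝ := fun x => trunc (ρ x - v x) with hφdef
  have hM : eLpNorm (incr φ) (ENNReal.ofReal p) (energyMeasure N s p)
      ≤ (ENNReal.ofReal (3 ^ p + 6 ^ p)
          * eLpNorm (incr ρ) (ENNReal.ofReal p) (energyMeasure N s p) ^ p) ^ p⁻¹ :=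
    (ENNReal.le_rpow_inv_iff (by linarith)).2 hE
  have hiρ := integrable_Jp_mul_of_finiteEnergy hp hρ hφ
  have hir := integrable_Jp_mul_of_finiteEnergy hp hr hφ
  have hmr := measurable_incr hr.measurable
  have hmφ := measurable_incr hφ.measurable
  have hmd := measurable_incr (hρ.sub hr).measurable
  have hG0 : ∀ z, 0 ≤ (Jp p (incr ρ z) - Jp p (incr v z)) * incr φ z := fun z => by
    refine Jp_sub_mul_nonneg hp ?_
    have := trunc_between (ρ z.1 - v z.1) (ρ z.2 - v z.2)
    have e : incr ρ z - incr v z = ρ z.1 - v z.1 - (ρ z.2 - v z.2) := by simp only [incr]; ring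
    rwa [e]
  have hGi : Integrable (fun z => (Jp p (incr ρ z) - Jp p (incr v z)) * incr φ z)
      (energyMeasure N s p) := by
    simpa only [sub_mul] using! hiρ.sub hiv
  rw [← ofReal_integral_eq_lintegral_ofReal hGi (.of_forall hG0)]
  have hstep : ∫ z, (Jp p (incr ρ z) - Jp p (incr v z)) * incr φ z ∂(energyMeasure N s p)
      ≤ ∫ z, (Jp p (incr ρ z) - Jp p (incr r z)) * incr φ z ∂(energyMeasure N s p) := by
    simp only [sub_mul]
    rw [integral_sub hiρ hiv, integral_sub hiρ hir]
    linarith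
  refine (ENNReal.ofReal_le_ofReal hstep).trans ?_
  refine (ENNReal.ofReal_le_ofReal (le_abs_self _)).trans ?_
  rw [← Real.enorm_eq_ofReal_abs]
  refine (enorm_integral_le_lintegral_enorm _).trans ?_
  calc ∫⁻ z, ‖(Jp p (incr ρ z) - Jp p (incr r z)) * incr φ z‖ₑ ∂(energyMeasure N s p)
      ≤ ∫⁻ z, (ENNReal.ofReal η * (‖incr r z‖ₑ ^ (p - 1) * ‖incr φ z‖ₑ)
          + ENNReal.ofReal C * (‖incr (fun x => ρ x - r x) z‖ₑ ^ (p - 1) * ‖incr φ z‖ₑ))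
          ∂(energyMeasure N s p) := by
        refine lintegral_mono fun z => ?_
        have hp1 : 0 ≤ p - 1 := by linarith
        have h1 := hJ (incr ρ z) (incr r z)
        have e : incr ρ z - incr r z = incr (fun x => ρ x - r x) z := by simp only [incr]; ring
        rw [e] at h1
        rw [enorm_mul, ← mul_assoc, ← mul_assoc, ← add_mul]
        gcongr
        rw [Real.enorm_eq_ofReal_abs, ← enorm_rpow_abs hp1, ← enorm_rpow_abs hp1,
          Real.enorm_of_nonneg (by positivity), Real.enorm_of_nonneg (by positivity),
          ← ENNReal.ofReal_mul hη, ← ENNReal.ofReal_mul hC,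
          ← ENNReal.ofReal_add (by positivity) (by positivity)]
        exact ENNReal.ofReal_le_ofReal h1
    _ = ENNReal.ofReal η * ∫⁻ z, ‖incr r z‖ₑ ^ (p - 1) * ‖incr φ z‖ₑ ∂(energyMeasure N s p)
        + ENNReal.ofReal C * ∫⁻ z, ‖incr (fun x => ρ x - r x) z‖ₑ ^ (p - 1) * ‖incr φ z‖ₑ
          ∂(energyMeasure N s p) := by
        have m1 : Measurable fun z => ‖incr r z‖ₑ ^ (p - 1) * ‖incr φ z‖ₑ :=
          (hmr.enorm.pow_const _).mul hmφ.enorm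
        have m2 : Measurable fun z => ‖incr (fun x => ρ x - r x) z‖ₑ ^ (p - 1) * ‖incr φ z‖ₑ :=
          (hmd.enorm.pow_const _).mul hmφ.enorm
        rw [lintegral_add_left (m1.const_mul _), lintegral_const_mul _ m1,
          lintegral_const_mul _ m2]
    _ ≤ _ := by
        rw [add_mul, mul_assoc, mul_assoc]
        gcongr
        · exact (lintegral_rpow_mul_le _ hp hmr hmφ).trans (by gcongr)
        · exact (lintegral_rpow_mul_le _ hp hmd hmφ).trans (by gcongr)

/-- The part of `u` above any positive level is dominated by `v`. -/
theorem IsRegularSolution.max_sub_le (hs0 : 0 < s) (hs1 : s < 1) (hp : 1 < p)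
    (hδ : 0 < δ) (hΩ : IsSmoothBoundedDomain Ω) (hf : IntegrableOn f Ω)
    (hf0 : ∀ᵐ x ∂(volume.restrict Ω), 0 ≤ f x)
    (hu : IsRegularSolution s p Ω f δ u) (hv : IsRegularSolution s p Ω f δ v) (hθ : 0 < θ) :
    ∀ᵐ x ∂volume, u x - θ ≤ v x := by
  set r : Heis N → ℝ := fun x => max (u x - θ) 0 with hrdef
  have hr0 : ∀ x, 0 ≤ r x := fun x => le_max_right _ _
  have hrm : Measurable r := (hu.measurable.sub_const θ).max measurable_const
  have hr : FiniteEnergy s p r :=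
    (hu.isWeakSolution.zeroOnBoundary.2 θ hθ).1.finiteEnergy hp hrm
  have hrΩ : ∀ x ∉ Ω, r x = 0 := fun x hx => by
    simp only [hrdef, hu.eq_zero x hx]
    exact max_eq_right (by linarith)
  obtain ⟨ψ, K, hψ, hK, hKΩ, hψK, hψE, hae⟩ := (hr.compactlyApproximable hs0 hs1 hp hΩ
    fun x hx => hrΩ x fun h => hx (subset_closure h)).exists_seq hp hr
  set ρ : ℕ → Heis N → ℝ := fun n x => min (r x) (ψ n x) with hρdef
  have hρ : ∀ n, FiniteEnergy s p (ρ n) := fun n => hr.inf (hψ n)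
  have hρK : ∀ n, ∀ x ∉ K n, ρ n x = 0 := fun n x hx => by
    simp only [hρdef, hψK n x hx]
    exact min_eq_right (hr0 x)
  have hρr : ∀ n x, ρ n x ≤ r x := fun n x => min_le_left _ _
  -- `r - min r ψ` is the positive part of `r - ψ`, so no continuity of `min` is needed
  have hρE : ∀ n, eLpNorm (incr fun x => ρ n x - r x) (ENNReal.ofReal p) (energyMeasure N s p)
      ≤ eLpNorm (incr fun x => r x - ψ n x) (ENNReal.ofReal p) (energyMeasure N s p) := fun n => by
    refine eLpNorm_mono fun z => ?_
    simp only [incr, hρdef, Real.norm_eq_abs]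
    grind
  have hρlim : Tendsto (fun n => eLpNorm (incr fun x => ρ n x - r x) (ENNReal.ofReal p)
      (energyMeasure N s p)) atTop (𝓝 0) :=
    tendsto_of_tendsto_of_tendsto_of_le_of_le tendsto_const_nhds hψE (fun _ => zero_le) hρE
  set m := energyMeasure N s p with hm
  set A := eLpNorm (incr r) (ENNReal.ofReal p) m with hA
  have hAt : A ≠ ⊤ := hr.incr_memLp.2.ne
  have hρA : ∀ᶠ n in atTop, eLpNorm (incr (ρ n)) (ENNReal.ofReal p) m ≤ A + 1 := by
    filter_upwards [hρlim.eventually (ge_mem_nhds one_pos)] with n hn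
    have e : incr (ρ n) = incr r + incr fun x => ρ n x - r x := by
      funext z; simp only [incr, Pi.add_apply]; ring
    rw [e]
    exact (eLpNorm_add_le hr.incr_memLp.1 ((hρ n).sub hr).incr_memLp.1 (by simpa using hp.le)).trans
      (add_le_add le_rfl hn)
  set M := (ENNReal.ofReal (3 ^ p + 6 ^ p) * (A + 1) ^ p) ^ p⁻¹ with hMdef
  have hp0 : 0 ≤ p := by linarith
  have hMt : M ≠ ⊤ := by
    refine (ENNReal.rpow_lt_top_of_nonneg (by positivity) (ENNReal.mul_lt_top
      ENNReal.ofReal_lt_top (ENNReal.rpow_lt_top_of_nonneg hp0 ?_)).ne).ne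
    finiteness
  set G : ℕ → Heis N × Heis N → ℝ := fun n z => (Jp p (incr (ρ n) z) - Jp p (incr v z))
    * incr (fun x => trunc (ρ n x - v x)) z with hG
  have hGlim : Tendsto (fun n => ∫⁻ z, ENNReal.ofReal (G n z) ∂m) atTop (𝓝 0) := by
    rw [ENNReal.tendsto_nhds_zero]
    intro ε hε
    set B := A ^ (p - 1) * M with hB
    have hBt : B ≠ ⊤ := ENNReal.mul_ne_top
      (ENNReal.rpow_lt_top_of_nonneg (by linarith) hAt).ne hMt
    obtain ⟨η, hη, hηB⟩ : ∃ η : ℝ, 0 < η ∧ ENNReal.ofReal η * B ≤ ε / 2 := by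
      have : Tendsto (fun η : ℝ => ENNReal.ofReal η * B) (𝓝[>] 0) (𝓝 0) := by
        have h1 : Tendsto (fun η : ℝ => ENNReal.ofReal η) (𝓝[>] 0) (𝓝 0) := by
          have := ENNReal.continuous_ofReal.tendsto 0
          rw [ENNReal.ofReal_zero] at this
          exact this.mono_left nhdsWithin_le_nhds
        have := ENNReal.Tendsto.mul_const h1 (b := B) (Or.inr hBt)
        rwa [zero_mul] at this
      obtain ⟨η, h1, h2⟩ := ((this.eventually (ge_mem_nhds (ENNReal.half_pos hε.ne'))).and
        self_mem_nhdsWithin).exists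
      exact ⟨η, h2, h1⟩
    obtain ⟨C, hC, hJ⟩ := abs_Jp_sub_le hp hη
    have hsecond : Tendsto (fun n => ENNReal.ofReal C * eLpNorm (incr fun x => ρ n x - r x)
        (ENNReal.ofReal p) m ^ (p - 1) * M) atTop (𝓝 0) := by
      have h1 : Tendsto (fun n => eLpNorm (incr fun x => ρ n x - r x)
          (ENNReal.ofReal p) m ^ (p - 1)) atTop (𝓝 0) := by
        have := hρlim.ennrpow_const (p - 1)
        rwa [ENNReal.zero_rpow_of_pos (by linarith)] at this
      have h2 := ENNReal.Tendsto.const_mul h1 (a := ENNReal.ofReal C) (Or.inr ENNReal.ofReal_ne_top)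
      have h3 := ENNReal.Tendsto.mul_const h2 (b := M) (Or.inr hMt)
      simpa using h3
    filter_upwards [hsecond.eventually (ge_mem_nhds (ENNReal.half_pos hε.ne')), hρA] with n h1 h2
    refine (hu.lintegral_monotone_le hs0 hs1 hp hδ hΩ.isOpen hf hf0 hv hθ hr (hρ n) (hK n) (hKΩ n)
      (hρK n) (hρr n) hη.le hC hJ).trans ?_
    calc _ ≤ (ENNReal.ofReal η * A ^ (p - 1) + ENNReal.ofReal C
            * eLpNorm (incr fun x => ρ n x - r x) (ENNReal.ofReal p) m ^ (p - 1)) * M := by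
          refine mul_le_mul' le_rfl ?_
          rw [hMdef]
          gcongr
      _ = ENNReal.ofReal η * B + ENNReal.ofReal C
            * eLpNorm (incr fun x => ρ n x - r x) (ENNReal.ofReal p) m ^ (p - 1) * M := by
          rw [add_mul, hB, mul_assoc]
      _ ≤ ε / 2 + ε / 2 := add_le_add hηB h1
      _ = ε := ENNReal.add_halves ε
  have hGm : ∀ n, Measurable (G n) := fun n =>
    (((continuous_Jp hp).measurable.comp (measurable_incr (hρ n).measurable)).sub
      ((continuous_Jp hp).measurable.comp (measurable_incr hv.measurable))).mul
      (measurable_incr (continuous_trunc.measurable.comp ((hρ n).measurable.sub hv.measurable)))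
  set G' : Heis N × Heis N → ℝ := fun z => (Jp p (incr r z) - Jp p (incr v z))
    * incr (fun x => trunc (r x - v x)) z with hG'
  have hGae : ∀ᵐ z ∂m, Tendsto (fun n => G n z) atTop (𝓝 (G' z)) := by
    have hρae : ∀ᵐ x ∂(volume : Measure (Heis N)), Tendsto (fun n => ρ n x) atTop (𝓝 (r x)) := by
      filter_upwards [hae] with x hx
      have := (tendsto_const_nhds (x := r x)).min hx
      rwa [min_self] at this
    refine energyMeasure_ac.ae_le ?_
    filter_upwards [Measure.quasiMeasurePreserving_fst.ae hρae,
      Measure.quasiMeasurePreserving_snd.ae hρae] with z h1 h2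
    have hd : Tendsto (fun n => incr (ρ n) z) atTop (𝓝 (incr r z)) := h1.sub h2
    have ht : Tendsto (fun n => incr (fun x => trunc (ρ n x - v x)) z) atTop
        (𝓝 (incr (fun x => trunc (r x - v x)) z)) :=
      ((continuous_trunc.tendsto _).comp (h1.sub_const _)).sub
        ((continuous_trunc.tendsto _).comp (h2.sub_const _))
    exact ((((continuous_Jp hp).tendsto _).comp hd).sub_const _).mul ht
  have hfatou : ∫⁻ z, ENNReal.ofReal (G' z) ∂m = 0 := by
    refine le_antisymm ?_ zero_le
    calc ∫⁻ z, ENNReal.ofReal (G' z) ∂m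
        = ∫⁻ z, liminf (fun n => ENNReal.ofReal (G n z)) atTop ∂m := by
          refine lintegral_congr_ae ?_
          filter_upwards [hGae] with z hz
          exact ((ENNReal.continuous_ofReal.tendsto _).comp hz).liminf_eq.symm
      _ ≤ liminf (fun n => ∫⁻ z, ENNReal.ofReal (G n z) ∂m) atTop :=
          lintegral_liminf_le fun n => (hGm n).ennreal_ofReal
      _ = 0 := hGlim.liminf_eq
  have hG'm : Measurable G' :=
    (((continuous_Jp hp).measurable.comp (measurable_incr hrm)).sub
      ((continuous_Jp hp).measurable.comp (measurable_incr hv.measurable))).mul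
      (measurable_incr (continuous_trunc.measurable.comp (hrm.sub hv.measurable)))
  have hinc : ∀ᵐ z ∂m, incr (fun x => trunc (r x - v x)) z = 0 := by
    filter_upwards [(lintegral_eq_zero_iff hG'm.ennreal_ofReal).1 hfatou] with z hz
    have hbet : Between (incr (fun x => trunc (r x - v x)) z) (incr r z - incr v z) := by
      have := trunc_between (r z.1 - v z.1) (r z.2 - v z.2)
      have e : incr r z - incr v z = r z.1 - v z.1 - (r z.2 - v z.2) := by simp only [incr]; ring
      rwa [e]
    exact eq_zero_of_Jp_sub_mul_eq_zero hp hbet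
      (le_antisymm (ENNReal.ofReal_eq_zero.1 hz) (Jp_sub_mul_nonneg hp hbet))
  have hzero := ae_eq_zero_of_incr_eq_zero hΩ.isBounded (φ := fun x => trunc (r x - v x))
    (fun x hx => trunc_of_nonpos (by rw [hrΩ x hx]; linarith [hv.nonneg x])) hinc
  filter_upwards [hzero] with x hx
  have h1 : u x - θ ≤ r x := le_max_left _ _
  by_contra! hlt
  have h2 : 0 < r x - v x := by linarith
  have h3 : 0 < trunc (r x - v x) := lt_min (lt_max_of_lt_left h2) one_pos
  exact h3.ne' hx

/-- The comparison principle for solutions with the same right-hand side. -/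
theorem IsRegularSolution.le (hs0 : 0 < s) (hs1 : s < 1) (hp : 1 < p)
    (hδ : 0 < δ) (hΩ : IsSmoothBoundedDomain Ω) (hf : IntegrableOn f Ω)
    (hf0 : ∀ᵐ x ∂(volume.restrict Ω), 0 ≤ f x)
    (hu : IsRegularSolution s p Ω f δ u) (hv : IsRegularSolution s p Ω f δ v) :
    ∀ᵐ x ∂volume, u x ≤ v x := by
  have h : ∀ n : ℕ, ∀ᵐ x ∂volume, u x - 1 / ((n : ℝ) + 1) ≤ v x := fun n =>
    hu.max_sub_le hs0 hs1 hp hδ hΩ hf hf0 hv (by positivity)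
  filter_upwards [ae_all_iff.2 h] with x hx
  have hlim : Tendsto (fun n : ℕ => u x - 1 / ((n : ℝ) + 1)) atTop (𝓝 (u x)) := by
    have := (tendsto_const_nhds (x := u x)).sub (tendsto_one_div_add_atTop_nhds_zero_nat (𝕜 := ℝ))
    rwa [sub_zero] at this
  exact le_of_tendsto' hlim hx

end Comparison

end HeisUniq

end

theorem theorem1p7 (N : ℕ) (hN : 2 ≤ N) (s p : ℝ) (hs0 : 0 < s) (hs1 : s < 1) (hp : 1 < p)
    (hsp : s * p < HeisUniq.homDim N)
    (Ω : Set (HeisUniq.Heis N)) (hΩ : HeisUniq.IsSmoothBoundedDomain Ω)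
    (δ : ℝ) (hδ : 0 < δ)
    (f : HeisUniq.Heis N → ℝ) (hf : MeasureTheory.IntegrableOn f Ω MeasureTheory.volume)
    (hf_nonneg : ∀ᵐ x ∂(MeasureTheory.volume.restrict Ω), 0 ≤ f x)
    (hf_ne : ¬ (∀ᵐ x ∂(MeasureTheory.volume.restrict Ω), f x = 0))
    (u v : HeisUniq.Heis N → ℝ)
    (hu : HeisUniq.IsWeakSolution s p Ω f (fun _ => δ) u)
    (hv : HeisUniq.IsWeakSolution s p Ω f (fun _ => δ) v) :
    ∀ᵐ x ∂(MeasureTheory.volume : MeasureTheory.Measure (HeisUniq.Heis N)), u x = v x := by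
  have hmain : ∀ w w' : HeisUniq.Heis N → ℝ,
      HeisUniq.IsWeakSolution s p Ω f (fun _ => δ) w →
      HeisUniq.IsWeakSolution s p Ω f (fun _ => δ) w' →
      ∀ᵐ x ∂(volume : Measure (HeisUniq.Heis N)), w x ≤ w' x := by
    intro w w' hw hw'
    obtain ⟨r, hwr, hr⟩ := hw.exists_isRegularSolution hΩ.isOpen
    obtain ⟨r', hwr', hr'⟩ := hw'.exists_isRegularSolution hΩ.isOpen
    filter_upwards [hwr, hwr', hr.le hs0 hs1 hp hδ hΩ hf hf_nonneg hr'] with x h1 h2 h3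
    rwa [h1, h2]
  filter_upwards [hmain u v hu hv, hmain v u hv hu] with x h1 h2
  exact le_antisymm h1 h2
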